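/- Let $N\ge 1$, $\hbar>0$, $\lambda=(\lambda_1,\dots,\lambda_N)\in\mathbb R^N$, $\xi_L^{(i)},\xi_R^{(i)}\in\mathbb C$ ($1\le i\le N-1$), $\rho_i=\tfrac12(N-2i+1)$ and $\mu_i=-\imath\hbar^{-1}\lambda_i-\rho_i$. Consider functions of the variables $T=(T_{k,i})_{1\le i\le k\le N-1}$. In the Gauss–Givental representation $\pi_\mu$ the generators $E_{i,i}$, $E_{i,i\pm1}$ of $\mathfrak{gl}(N)$ act by the operators (with $T_{N,i}=0$, and derivatives $\partial/\partial T_{k,i}$ omitted unless $1\le i\le k\le N-1$) $$E_{i,i}=\mu_i+\sum_{k=1}^{i-1}\frac{\partial}{\partial T_{N+k-i,k}}-\sum_{k=i}^{N-1}\frac{\partial}{\partial T_{k,i}},$$ $$E_{i,i+1}=\sum_{n=1}^{i}\Big(\sum_{k=n}^{i}e^{T_{N+k-i,k}-T_{N+k-i-1,k}}\Big)\Big(\frac{\partial}{\partial T_{N+n-i-1,n}}-\frac{\partial}{\partial T_{N+n-i-1,n-1}}\Big),$$ $$E_{i+1,i}=\sum_{k=i}^{N-1}e^{T_{k,i}-T_{k+1,i+1}}\Big(\mu_i-\mu_{i+1}+\sum_{s=i}^{k}\Big(\frac{\partial}{\partial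 T_{s,i+1}}-\frac{\partial}{\partial T_{s,i}}\Big)\Big).$$ Put (again with $T_{N,i}=0$) $$\psi_R=\exp\Big\{\sum_{i=1}^{N-1}\xi_R^{(i)}\sum_{k=i}^{N-1}e^{T_{k,i}-T_{k+1,i+1}}\Big\},\qquad \psi_L=\exp\Big\{\sum_{k=1}^{N-1}\sum_{i=1}^{k}(\mu_k-\mu_{k+1})T_{k,i}+\sum_{i=1}^{N-1}\xi_L^{(i)}\sum_{k=1}^{N-i}e^{T_{k+i,k}-T_{k+i-1,k}}\Big\}.$$ For $x\in\mathbb R^N$ let $$\big(\pi_\mu(e^{-\sum_i x_iE_{i,i}})f\big)(T)=e^{-\sum_i\mu_ix_i}\,f\big((T_{k,i}+x_i-x_{N+i-k})_{k,i}\big).$$ A contour $\Gamma$ is a finite integral combination of smooth proper maps from $\mathbb R^{N(N-1)/2}$ to the space $\mathbb C^{N(N-1)/2}$ of the variables $T$. Let $\bar\phi(T)=\overline{\phi(\overline T)}$ and $$\langle\phi,\psi\rangle=\int_\Gamma \bar\phi(T)\,\psi(T)\prod_{k=1}^{N-1}\prod_{i=1}^{k}e^{T_{k,i}}\,dT_{k,i}.$$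 Call $\Gamma$ admissible if for every $x\in\mathbb R^N$ the integral defining $\langle\psi_L,\pi_\mu(e^{-\sum x_iE_{i,i}})\psi_R\rangle$ converges absolutely (with respect to the Riemannian volume of each piece of $\Gamma$) on $\Gamma$ and on all translates $\{(T_{k,i}+y_i)\}$, $y\in\mathbb R^N$, locally uniformly in $y$ (domination by an integrable function for $y$ in bounded sets). The wave function of the open Toda chain is the matrix element $$\Psi_\lambda^{(N)}(x_1,\dots,x_N)=e^{-\sum_i x_i\rho_i}\,\big\langle\psi_L,\ \pi_\mu(e^{-\sum_i x_iE_{i,i}})\,\psi_R\big\rangle .$$ **Theorem.** (a) $E_{i,i+1}\psi_R=\xi_R^{(i)}\psi_R$ and $E_{i+1,i}\psi_L=\xi_L^{(N-i)}\psi_L$ for $1\le i\le N-1$, and $x\mapsto\pi_\mu(e^{-\sum x_iE_{i,i}})$ integrates the action of the Cartan subalgebra: for every holomorphic $f$, every $x\in\mathbb R^N$ and every $s\in\mathbb R$, $\pi_\mu(e^{0})f=f$ and $\frac{d}{ds}\pi_\mu(e^{-s\sum x_iE_{i,i}})f=-\sum_i x_iE_{i,i}\,\pi_\mu(e^{-s\sum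 x_iE_{i,i}})f$ pointwise. (b) For every admissible $\Gamma$ and every $x\in\mathbb R^N$, writing $T_{N,i}=x_i$, both the integral defining $\Psi_\lambda^{(N)}(x)$ and the following integral converge absolutely, and $$\Psi_\lambda^{(N)}(x)=\int_\Gamma\exp\Big\{\frac{\imath}{\hbar}\sum_{k=1}^N\lambda_k\Big(\sum_{i=1}^kT_{k,i}-\sum_{i=1}^{k-1}T_{k-1,i}\Big)\Big\}\exp\Big\{\sum_{i=1}^{N-1}\bar\xi_L^{(i)}\sum_{k=1}^{N-i}e^{T_{k+i,k}-T_{k+i-1,k}}+\sum_{i=1}^{N-1}\xi_R^{(i)}\sum_{k=i}^{N-1}e^{T_{k,i}-T_{k+1,i+1}}\Big\}\prod_{k=1}^{N-1}\prod_{i=1}^kdT_{k,i}.$$ (c) If $\xi_L^{(i)}=\xi_R^{(i)}=-1/\hbar$ for all $i$, then for every admissible $\Gamma$ and every $x$ this is Givental's formula $\Psi_\lambda^{(N)}(x)=\int_\Gamma e^{\frac1\hbar\mathcal F_N(T)}\prod dT_{k,i}$ with $$\mathcal F_N(T)=\imath\sum_{k=1}^N\lambda_k\Big(\sum_{i=1}^kT_{k,i}-\sum_{i=1}^{k-1}T_{k-1,i}\Big)-\sum_{k=1}^{N-1}\sum_{i=1}^k\big(e^{T_{k+1,i}-T_{k,i}}+e^{T_{k,i}-T_{k+1,i+1}}\big);$$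 moreover $\Gamma=\mathbb R^{N(N-1)/2}$ is admissible, and for it the formula holds with an absolutely convergent Lebesgue integral. -/

import Mathlib

open Finset MeasureTheory Filter
open scoped BigOperators ContDiff

namespace GaussGivental

noncomputable section

/-- The triangular index set of the variables `T_{k,i}`, `1 ≤ i ≤ k ≤ N - 1`;
the pair is `(k, i)`. -/
abbrev Idx (N : ℕ) : Type :=
  {p : ℕ × ℕ // p ∈ (Finset.range N ×ˢ Finset.range N).filter (fun p => 1 ≤ p.2 ∧ p.2 ≤ p.1)}

/-- The space of (complex) variables `T_{k,i}`, i.e. the universal cover of the complex torus with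
coordinates `exp T_{k,i}`; functions such as `exp (i λ T)` are single valued on it. -/
abbrev Coord (N : ℕ) : Type := Idx N → ℂ

/-- The variable `T_{k,i}` for all `k ≤ N`, the bottom row being `T_{N,i} = x_i`. -/
def ext (N : ℕ) (x : ℕ → ℝ) (T : Coord N) (k i : ℕ) : ℂ :=
  if h : (k, i) ∈ (Finset.range N ×ˢ Finset.range N).filter (fun p => 1 ≤ p.2 ∧ p.2 ≤ p.1) then
    T ⟨(k, i), h⟩
  else if k = N then (x i : ℂ) else 0

/-- The variable `T_{k,i}` with the convention `T_{N,i} = 0` of the representation. -/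
def var (N : ℕ) (T : Coord N) (k i : ℕ) : ℂ := ext N (fun _ => 0) T k i

/-- The derivative `∂ / ∂T_{k,i}`, omitted (zero) unless `1 ≤ i ≤ k ≤ N - 1`. -/
def pd (N k i : ℕ) (f : Coord N → ℂ) (T : Coord N) : ℂ :=
  if h : (k, i) ∈ (Finset.range N ×ˢ Finset.range N).filter (fun p => 1 ≤ p.2 ∧ p.2 ≤ p.1) then
    fderiv ℂ f T (Pi.single (⟨(k, i), h⟩ : Idx N) 1)
  else 0

/-- `ρ_i = (N - 2 i + 1) / 2`. -/
def rho (N i : ℕ) : ℝ := ((N : ℝ) - 2 * (i : ℝ) + 1) / 2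

/-- `μ_i = - i λ_i / ħ - ρ_i`. -/
def mu (N : ℕ) (hbar : ℝ) (lam : ℕ → ℝ) (i : ℕ) : ℂ :=
  -Complex.I * ((lam i / hbar : ℝ) : ℂ) - (rho N i : ℂ)

/-! ### The Gauss–Givental representation -/

/-- The Cartan generator `E_{i,i}`. -/
def Ediag (N : ℕ) (m : ℕ → ℂ) (i : ℕ) (f : Coord N → ℂ) (T : Coord N) : ℂ :=
  m i * f T + ∑ k ∈ Finset.Icc 1 (i - 1), pd N (N + k - i) k f T
    - ∑ k ∈ Finset.Icc i (N - 1), pd N k i f T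

/-- The generator `E_{i,i+1}`. -/
def Eup (N : ℕ) (i : ℕ) (f : Coord N → ℂ) (T : Coord N) : ℂ :=
  ∑ n ∈ Finset.Icc 1 i,
    (∑ k ∈ Finset.Icc n i, Complex.exp (var N T (N + k - i) k - var N T (N + k - i - 1) k)) *
      (pd N (N + n - i - 1) n f T - pd N (N + n - i - 1) (n - 1) f T)

/-- The generator `E_{i+1,i}`. -/
def Elow (N : ℕ) (m : ℕ → ℂ) (i : ℕ) (f : Coord N → ℂ) (T : Coord N) : ℂ :=
  ∑ k ∈ Finset.Icc i (N - 1),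
    Complex.exp (var N T k i - var N T (k + 1) (i + 1)) *
      ((m i - m (i + 1)) * f T + ∑ s ∈ Finset.Icc i k, (pd N s (i + 1) f T - pd N s i f T))

/-- `ψ` is a Whittaker vector for the character `E_{i,i+1} ↦ ξ_R^{(i)}`. -/
def IsRightWhittaker (N : ℕ) (xiR : ℕ → ℂ) (psi : Coord N → ℂ) : Prop :=
  ∀ i ∈ Finset.Icc 1 (N - 1), ∀ T : Coord N, Eup N i psi T = xiR i * psi T

/-- `ψ` is a Whittaker vector for the character `E_{i+1,i} ↦ ξ_L^{(N-i)}`. -/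
def IsLeftWhittaker (N : ℕ) (m : ℕ → ℂ) (xiL : ℕ → ℂ) (psi : Coord N → ℂ) : Prop :=
  ∀ i ∈ Finset.Icc 1 (N - 1), ∀ T : Coord N, Elow N m i psi T = xiL (N - i) * psi T

/-- The right Whittaker vector `ψ_R`. -/
def psiR (N : ℕ) (xiR : ℕ → ℂ) (T : Coord N) : ℂ :=
  Complex.exp (∑ i ∈ Finset.Icc 1 (N - 1), xiR i *
    ∑ k ∈ Finset.Icc i (N - 1), Complex.exp (var N T k i - var N T (k + 1) (i + 1)))

/-- The left Whittaker vector `ψ_L`. -/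
def psiL (N : ℕ) (m : ℕ → ℂ) (xiL : ℕ → ℂ) (T : Coord N) : ℂ :=
  Complex.exp
    (∑ k ∈ Finset.Icc 1 (N - 1), ∑ i ∈ Finset.Icc 1 k, (m k - m (k + 1)) * var N T k i +
      ∑ i ∈ Finset.Icc 1 (N - 1), xiL i *
        ∑ k ∈ Finset.Icc 1 (N - i), Complex.exp (var N T (k + i) k - var N T (k + i - 1) k))

/-- The action of the Cartan torus element `exp (- ∑ x_i E_{i,i})`: multiplication by
`exp (- ∑ μ_i x_i)` composed with the translation `T_{k,i} ↦ T_{k,i} + x_i - x_{N+i-k}`. -/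
def cartan (N : ℕ) (m : ℕ → ℂ) (x : ℕ → ℝ) (f : Coord N → ℂ) (T : Coord N) : ℂ :=
  Complex.exp (-∑ i ∈ Finset.Icc 1 N, m i * (x i : ℂ)) *
    f (fun p => T p + (x p.1.2 : ℂ) - (x (N + p.1.2 - p.1.1) : ℂ))

/-- `cartan` integrates the action of the Cartan subalgebra: for every holomorphic `f`, the
one-parameter family `exp (- s ∑ x_i E_{i,i}) f` starts at `f` and has
`s`-derivative `(- ∑ x_i E_{i,i}) exp (- s ∑ x_i E_{i,i}) f`. -/
def IntegratesCartan (N : ℕ) (m : ℕ → ℂ)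
    (act : (ℕ → ℝ) → (Coord N → ℂ) → (Coord N → ℂ)) : Prop :=
  ∀ f : Coord N → ℂ, Differentiable ℂ f → ∀ (x : ℕ → ℝ) (T : Coord N),
    act 0 f T = f T ∧
    ∀ s : ℝ, HasDerivAt (fun t : ℝ => act (t • x) f T)
      (-∑ i ∈ Finset.Icc 1 N, (x i : ℂ) * Ediag N m i (act (s • x) f) T) s

/-! ### Contours and integration -/

/-- A middle-dimensional cycle `Γ` without boundary in the space of the variables `T`: a finite
integral combination of smooth proper maps from the real space of dimension `N (N - 1) / 2`. -/
structure Contour (N : ℕ) where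
  pieces : ℕ
  mult : Fin pieces → ℤ
  map : Fin pieces → (Idx N → ℝ) → Coord N
  smooth : ∀ j, ContDiff ℝ ∞ (map j)
  proper : ∀ j, Tendsto (map j) (cocompact (Idx N → ℝ)) (cocompact (Coord N))

/-- The complex Jacobian matrix `∂T_p / ∂u_q` of a piece of the contour. -/
def Contour.jac {N : ℕ} (G : Contour N) (j : Fin G.pieces) (u : Idx N → ℝ) :
    Matrix (Idx N) (Idx N) ℂ :=
  Matrix.of fun p q => fderiv ℝ (G.map j) u (Pi.single q 1) p

/-- The Riemannian volume density of a piece of the contour in the Euclidean space of the `T`: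
the square root of the Gram determinant of the tangent vectors. -/
def Contour.vol {N : ℕ} (G : Contour N) (j : Fin G.pieces) (u : Idx N → ℝ) : ℝ :=
  Real.sqrt (Matrix.det (((G.jac j u).conjTranspose * G.jac j u).map Complex.re))

/-- The integral of the holomorphic form `F(T) ∏ dT_{k,i}` over the contour. -/
def Contour.integral {N : ℕ} (G : Contour N) (F : Coord N → ℂ) : ℂ :=
  ∑ j, (G.mult j : ℂ) * ∫ u : Idx N → ℝ, F (G.map j u) * (G.jac j u).det

/-- Absolute convergence of the integral of `F` over the contour. -/
def Contour.Converges {N : ℕ} (G : Contour N) (F : Coord N → ℂ) : Prop :=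
  ∀ j, Integrable (fun u : Idx N → ℝ => ‖F (G.map j u)‖ * G.vol j u)

/-- The real contour `T_{k,i} ∈ ℝ`. -/
def realContour (N : ℕ) : Contour N where
  pieces := 1
  mult := fun _ => 1
  map := fun _ u p => (u p : ℂ)
  smooth := fun _ => by
    refine contDiff_pi.2 fun p => ?_
    exact Complex.ofRealCLM.contDiff.comp (contDiff_apply ℝ ℝ p)
  proper := fun _ => by
    have h : Topology.IsClosedEmbedding (fun (u : Idx N → ℝ) (p : Idx N) => (u p : ℂ)) := by
      refine Isometry.isClosedEmbedding (Isometry.of_dist_eq fun u v => ?_)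
      rw [dist_pi_def, dist_pi_def]
      congr 1
      refine Finset.sup_congr rfl fun p _ => ?_
      apply NNReal.eq
      simp only [coe_nndist]
      exact Complex.isometry_ofReal.dist_eq _ _
    exact h.tendsto_cocompact

/-! ### The pairing and the wave function -/

/-- The conjugate function `φ̄(T)`, which is `conj (φ(T))` on the real subspace and is
holomorphic in `T` when `φ` is. -/
def bar {N : ℕ} (phi : Coord N → ℂ) (T : Coord N) : ℂ :=
  (starRingEnd ℂ) (phi (fun p => (starRingEnd ℂ) (T p)))

/-- The integrand of the pairing, with the density of `ω = ⋀ exp(T_{k,i}) dT_{k,i}`. -/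
def pairingIntegrand {N : ℕ} (phi psi : Coord N → ℂ) (T : Coord N) : ℂ :=
  Complex.exp (∑ p, T p) * bar phi T * psi T

/-- The pairing `⟨φ, ψ⟩ = ∫_Γ ω φ̄ ψ`. -/
def pairing {N : ℕ} (G : Contour N) (phi psi : Coord N → ℂ) : ℂ :=
  G.integral (pairingIntegrand phi psi)

/-- The integrand of the matrix element `⟨ψ_L, exp (- ∑ x_i E_{i,i}) ψ_R⟩`. -/
def matrixElementIntegrand (N : ℕ) (hbar : ℝ) (lam : ℕ → ℝ) (xiL xiR : ℕ → ℂ)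
    (x : ℕ → ℝ) : Coord N → ℂ :=
  pairingIntegrand (psiL N (mu N hbar lam) xiL)
    (cartan N (mu N hbar lam) x (psiR N xiR))

/-- The wave function `Ψ_λ(x_1, …, x_N)`, defined as a Whittaker matrix element. -/
def waveFunction (N : ℕ) (hbar : ℝ) (lam : ℕ → ℝ) (xiL xiR : ℕ → ℂ) (G : Contour N)
    (x : ℕ → ℝ) : ℂ :=
  Complex.exp (-∑ i ∈ Finset.Icc 1 N, (x i : ℂ) * (rho N i : ℂ)) *
    pairing G (psiL N (mu N hbar lam) xiL) (cartan N (mu N hbar lam) x (psiR N xiR))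

/-- The contour is chosen so that the matrix element converges: for every `x` the matrix element
integral converges absolutely on `Γ` and on its real translates `T_{k,i} ↦ T_{k,i} + y_i`
(the part of the Cartan torus which acts on the left vector), locally uniformly in `y`. -/
def Contour.Admissible {N : ℕ} (G : Contour N) (hbar : ℝ) (lam : ℕ → ℝ)
    (xiL xiR : ℕ → ℂ) : Prop :=
  ∀ (x : ℕ → ℝ) (r : ℝ) (j : Fin G.pieces), ∃ g : (Idx N → ℝ) → ℝ, Integrable g ∧
    ∀ y : ℕ → ℝ, (∀ i ∈ Finset.Icc 1 N, |y i| ≤ r) → ∀ u : Idx N → ℝ,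
      ‖matrixElementIntegrand N hbar lam xiL xiR x
        (fun p => G.map j u p + (y p.1.2 : ℂ))‖ * G.vol j u ≤ g u

/-- `√(-1) ∑_k λ_k (∑_{i ≤ k} T_{k,i} - ∑_{i ≤ k-1} T_{k-1,i})`, with `T_{N,i} = x_i`. -/
def linearTerm (N : ℕ) (lam : ℕ → ℝ) (x : ℕ → ℝ) (T : Coord N) : ℂ :=
  Complex.I * ∑ k ∈ Finset.Icc 1 N, (lam k : ℂ) *
    (∑ i ∈ Finset.Icc 1 k, ext N x T k i - ∑ i ∈ Finset.Icc 1 (k - 1), ext N x T (k - 1) i)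

/-- The integrand of the integral representation, with `T_{N,i} = x_i`. -/
def giventalIntegrand (N : ℕ) (hbar : ℝ) (lam : ℕ → ℝ) (xiL xiR : ℕ → ℂ) (x : ℕ → ℝ)
    (T : Coord N) : ℂ :=
  Complex.exp (1 / (hbar : ℂ) * linearTerm N lam x T) *
    Complex.exp
      (∑ i ∈ Finset.Icc 1 (N - 1), (starRingEnd ℂ) (xiL i) *
          ∑ k ∈ Finset.Icc 1 (N - i), Complex.exp (ext N x T (k + i) k - ext N x T (k + i - 1) k) +
        ∑ i ∈ Finset.Icc 1 (N - 1), xiR i *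
          ∑ k ∈ Finset.Icc i (N - 1), Complex.exp (ext N x T k i - ext N x T (k + 1) (i + 1)))

/-- Givental's potential `F_N(T)`, with `T_{N,i} = x_i`. -/
def potential (N : ℕ) (lam : ℕ → ℝ) (x : ℕ → ℝ) (T : Coord N) : ℂ :=
  linearTerm N lam x T -
    ∑ k ∈ Finset.Icc 1 (N - 1), ∑ i ∈ Finset.Icc 1 k,
      (Complex.exp (ext N x T (k + 1) i - ext N x T k i) +
        Complex.exp (ext N x T k i - ext N x T (k + 1) (i + 1)))

end

end GaussGivental

/-! The heart of the matter is a change of variables. Under $T_{k,i}\mapsto T_{k,i}+x_i$ the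
Givental integrand becomes the integrand of the matrix element times $e^{-\sum x_i\rho_i}$
(`giventalIntegrand_add_colShift`): the measure $\prod e^{T_{k,i}}$ is absorbed by
$\rho_k-\rho_{k+1}=1$, and the phases are matched by summation by parts. On a general contour this
translation moves the contour, so one needs the integral of a holomorphic top form to be translation
invariant (`integral_comp_add_mul_det_jacobian`).

For that, average $F$ over the segment from $T$ to $T+v$ to get $P$ with $\partial_vP=F(\cdot+v)-F$.
The difference of the two integrands is then the exact form $d(P\,\iota_v dT)$. Stokes' theorem is
applied after multiplication by a cutoff $\chi_k$ with gradient $O(1/k)$. Properness makes $\chi_k$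
compactly supported on the contour, and the error term is at most $O(1/k)$ times the integral of the
dominating function supplied by admissibility. Two facts support this: cofactors of a Jacobian are
divergence free, and determinants with one row replaced by a covector are bounded by the Riemannian
volume density.

The Whittaker equations hold because every sum of derivatives telescopes, the only surviving term
sitting in the bottom row, where $T_{N,i}=0$. The Cartan statement is the chain rule along a line of
translates. The real contour is admissible because the Toda energy bounds each $|T_{k,i}|$ up to a
constant: $T_{k,i}$ is joined to the bottom row by one path from above and one from below, and $a\le
e^a$ on each edge. -/

namespace GaussGivental

/-! ### Determinants bounded by the Gram volume. -/

section Gram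

variable {n : Type*} [Fintype n]

/-- The real and imaginary parts of a complex matrix, stacked. -/
def realStack (A : Matrix n n ℂ) : Matrix (n ⊕ n) n ℝ :=
  Matrix.fromRows (A.map Complex.re) (A.map Complex.im)

/-- Since $\mathrm{Re}(\bar a b)=\mathrm{Re}\,a\,\mathrm{Re}\,b+\mathrm{Im}\,a\,\mathrm{Im}\,b$, the
Riemannian Gram matrix is a genuine real one. Hence it is positive semidefinite, and its kernel
consists of real relations among the columns. -/
lemma realStack_gram (A : Matrix n n ℂ) :
    (A.conjTranspose * A).map Complex.re = (realStack A).conjTranspose * realStack A := by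
  ext p q
  simp [realStack, Matrix.mul_apply, Finset.sum_add_distrib]

lemma realStack_mul_map (A : Matrix n n ℂ) (S : Matrix n n ℝ) :
    realStack (A * S.map Complex.ofReal) = realStack A * S := by
  ext (p | p) q <;> simp [realStack, Matrix.mul_apply]

lemma norm_apply_le_one_of_realStack_gram [DecidableEq n] (A : Matrix n n ℂ)
    (h : (realStack A).conjTranspose * realStack A = 1) (r q : n) : ‖A r q‖ ≤ 1 := by
  have h1 : ((realStack A).conjTranspose * realStack A) q q = 1 := by rw [h]; simp
  have h2 : ∑ s : n, ‖A s q‖ ^ 2 = 1 := by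
    rw [← h1]
    simp only [Matrix.mul_apply, Fintype.sum_sum_type, ← Finset.sum_add_distrib]
    refine Finset.sum_congr rfl fun s _ => ?_
    rw [← Complex.normSq_eq_norm_sq, Complex.normSq_apply]
    simp [realStack]
  have h3 : ‖A r q‖ ^ 2 ≤ 1 := by
    rw [← h2]
    exact Finset.single_le_sum (f := fun s => ‖A s q‖ ^ 2) (fun s _ => by positivity)
      (Finset.mem_univ r)
  exact (sq_le_one_iff₀ (norm_nonneg _)).1 h3

open scoped MatrixOrder Matrix.Norms.L2Operator in
/-- The value of a decomposable real-multilinear form of norm at most one on the columns of a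
complex matrix is bounded by the volume of the parallelotope that they span. -/
theorem norm_det_le_factorial_mul_sqrt_gram [DecidableEq n] (A : Matrix n n ℂ) (l : n → (n → ℂ) →L[ℝ] ℂ)
    (hl : ∀ p, ‖l p‖ ≤ 1) :
    ‖(Matrix.of fun p q => l p (fun r => A r q)).det‖ ≤
      (Fintype.card n).factorial *
        Real.sqrt (Matrix.det ((A.conjTranspose * A).map Complex.re)) := by
  set M : Matrix n n ℂ := Matrix.of fun p q => l p (fun r => A r q) with hM
  -- The forms `l p` are only real-linear, so columns may be recombined with real coefficients only.
  have hMS (S : Matrix n n ℝ) : M * S.map Complex.ofReal =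
      Matrix.of fun p q => l p (fun r => (A * S.map Complex.ofReal) r q) := by
    ext p q
    have : (fun r => (A * S.map Complex.ofReal) r q) = ∑ s, S s q • fun r => A r s := by
      ext r
      simp [Matrix.mul_apply, mul_comm]
    rw [Matrix.of_apply, this]
    simp [Matrix.mul_apply, hM, mul_comm]
  rw [realStack_gram]
  set G := (realStack A).conjTranspose * realStack A with hG
  have hpsd : G.PosSemidef := Matrix.posSemidef_conjTranspose_mul_self _
  by_cases hdet : G.det = 0
  -- Degenerate case: a kernel vector of the Gram matrix is a real relation among the columns, and
  -- the `l p` carry it over to `M`.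
  · obtain ⟨c, hc, hGc⟩ := Matrix.exists_mulVec_eq_zero_iff.2 hdet
    have hBc : (realStack A).mulVec c = 0 := by
      rw [hG] at hGc
      exact (Matrix.conjTranspose_mul_self_mulVec_eq_zero _ _).1 hGc
    have hAc : ∑ s, c s • (fun r => A r s) = 0 := by
      ext r
      apply Complex.ext
      · simpa [realStack, Matrix.mulVec, dotProduct, mul_comm] using congrFun hBc (Sum.inl r)
      · simpa [realStack, Matrix.mulVec, dotProduct, mul_comm] using congrFun hBc (Sum.inr r)
    have : M.det = 0 := by
      refine Matrix.exists_mulVec_eq_zero_iff.1 ⟨fun s => (c s : ℂ), ?_, ?_⟩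
      · intro h
        exact hc (funext fun s => by simpa using congrFun h s)
      · ext p
        have := congrArg (l p) hAc
        simpa [hM, Matrix.mulVec, dotProduct, mul_comm] using this
    rw [this, norm_zero]
    positivity
  -- Factoring $G=B^*B$ makes the columns of $AB^{-1}$ orthonormal over the reals. So $MB^{-1}$ has
  -- entries of norm at most one, the Leibniz expansion gives the factorial, and $|\det
  -- B|=\sqrt{\det G}$ restores the volume.
  · obtain ⟨B, hB⟩ := CStarAlgebra.nonneg_iff_eq_star_mul_self.mp
      (Matrix.nonneg_iff_posSemidef.2 hpsd)
    have hBdet : G.det = B.det ^ 2 := by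
      rw [hB, Matrix.star_eq_conjTranspose, Matrix.det_mul, Matrix.det_conjTranspose, sq]; simp
    have hBu : IsUnit B.det := by
      rw [isUnit_iff_ne_zero]; rintro h; exact hdet (by rw [hBdet, h]; simp)
    have hgram : (realStack (A * B⁻¹.map Complex.ofReal)).conjTranspose *
        realStack (A * B⁻¹.map Complex.ofReal) = 1 := by
      rw [realStack_mul_map, Matrix.conjTranspose_mul, Matrix.mul_assoc,
        ← Matrix.mul_assoc (realStack A).conjTranspose, ← hG, hB, Matrix.star_eq_conjTranspose,
        Matrix.mul_assoc, Matrix.mul_nonsing_inv _ hBu, Matrix.mul_one,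
        ← Matrix.conjTranspose_mul, Matrix.mul_nonsing_inv _ hBu, Matrix.conjTranspose_one]
    have hent : ∀ p q, ‖(M * B⁻¹.map Complex.ofReal) p q‖ ≤ 1 := by
      intro p q
      rw [hMS]
      refine ((l p).le_of_opNorm_le (hl p) _).trans ?_
      rw [one_mul]
      exact (pi_norm_le_iff_of_nonneg zero_le_one).2 fun r =>
        norm_apply_le_one_of_realStack_gram _ hgram r q
    have h1 : ‖(M * B⁻¹.map Complex.ofReal).det‖ ≤ (Fintype.card n).factorial := by
      have := Matrix.det_le (abv := NormedField.toAbsoluteValue ℂ) (x := 1) hent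
      rw [one_pow, nsmul_eq_mul, mul_one] at this
      exact this
    have h2 : M.det = (M * B⁻¹.map Complex.ofReal).det * (B.det : ℂ) := by
      have h3 : (B.det : ℂ) = (B.map Complex.ofReal).det :=
        (RingHom.map_det Complex.ofRealHom B)
      have h4 : B⁻¹.map Complex.ofReal * B.map Complex.ofReal = 1 := by
        have := congrArg (fun X : Matrix n n ℝ => X.map Complex.ofRealHom)
          (Matrix.nonsing_inv_mul B hBu)
        rw [Matrix.map_mul, Matrix.map_one _ (map_zero _) (map_one _)] at this
        exact this
      rw [h3, ← Matrix.det_mul, Matrix.mul_assoc, h4, Matrix.mul_one]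
    rw [h2, norm_mul, hBdet, Real.sqrt_sq_eq_abs, Complex.norm_real, Real.norm_eq_abs]
    gcongr

end Gram

/-! ### Divergence-free cofactors of a Jacobian (the Piola identity). -/

section NullLagrangian

variable {n : Type*} [Fintype n] [DecidableEq n]

/-- The complex Jacobian matrix of a smooth map from a real space to a complex one. -/
noncomputable def jacobian (γ : (n → ℝ) → n → ℂ) (u : n → ℝ) : Matrix n n ℂ :=
  Matrix.of fun p q => fderiv ℝ γ u (Pi.single q 1) p

variable (n) in
/-- The determinant as a real-multilinear function of the columns. -/
noncomputable def detCols : ContinuousMultilinearMap ℝ (fun _ : n => n → ℂ) ℂ where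
  toMultilinearMap :=
    (Matrix.detRowAlternating (n := n) (R := ℂ)).toMultilinearMap.restrictScalars ℝ
  cont := by
    change Continuous fun M : n → n → ℂ => Matrix.det (Matrix.of M)
    fun_prop

lemma detCols_apply (M : n → n → ℂ) : detCols n M = Matrix.det (Matrix.of M) := rfl

lemma detCols_update_update_swap (c : n → n → ℂ) (e h : n → ℂ) {q r : n} (hqr : q ≠ r) :
    detCols n (Function.update (Function.update c r e) q h) =
      -detCols n (Function.update (Function.update c q e) r h) := by
  have := (Matrix.detRowAlternating (n := n) (R := ℂ)).map_swap
    (Function.update (Function.update c q e) r h) hqr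
  refine Eq.trans ?_ this
  change Matrix.detRowAlternating _ = _
  congr 1
  funext s
  change Function.update (Function.update c r e) q h s = _
  rcases eq_or_ne s q with rfl | hq
  · simp
  rcases eq_or_ne s r with rfl | hr
  · simp [hqr, hq]
  · simp [Equiv.swap_apply_of_ne_of_ne hq hr, hq, hr]

/-- As a multilinear function of the partial derivatives of `γ`, a cofactor can be differentiated by
the product rule. -/
lemma adjugate_jacobian_apply (γ : (n → ℝ) → n → ℂ) (u : n → ℝ) (p q : n) :
    (jacobian γ u).adjugate q p = detCols n
      (Function.update (fun r => fderiv ℝ γ u (Pi.single r 1)) q (Pi.single p 1)) := by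
  rw [← Matrix.transpose_apply (Matrix.adjugate _), Matrix.adjugate_transpose,
    Matrix.adjugate_apply, detCols_apply]
  rfl

lemma hasFDerivAt_adjugate_jacobian {γ : (n → ℝ) → n → ℂ} (hγ : ContDiff ℝ ∞ γ) (u : n → ℝ)
    (p q : n) : HasFDerivAt (fun u => (jacobian γ u).adjugate q p)
      (((detCols n).linearDeriv
        (Function.update (fun r => fderiv ℝ γ u (Pi.single r 1)) q (Pi.single p 1))).comp
        (ContinuousLinearMap.pi fun r => if r = q then 0 else
          (fderiv ℝ (fderiv ℝ γ) u).flip (Pi.single r 1))) u := by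
  have h : ∀ r, HasFDerivAt (fun v : n → ℝ => Function.update
      (fun r => fderiv ℝ γ v (Pi.single r 1)) q (Pi.single p (1 : ℂ)) r)
      (if r = q then 0 else (fderiv ℝ (fderiv ℝ γ) u).flip (Pi.single r 1)) u := by
    intro r
    by_cases hr : r = q
    · subst hr
      simpa using hasFDerivAt_const (𝕜 := ℝ) (Pi.single p 1 : n → ℂ) u
    · simp only [Function.update_of_ne hr, if_neg hr]
      have h : DifferentiableAt ℝ (fderiv ℝ γ) u :=
        ((hγ.fderiv_right (m := ∞) (by simp)).differentiable (by simp)) u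
      have h1 := h.hasFDerivAt.clm_apply (hasFDerivAt_const (Pi.single r 1 : n → ℝ) u)
      rw [ContinuousLinearMap.comp_zero, zero_add] at h1
      exact h1
  simp only [adjugate_jacobian_apply]
  exact (ContinuousMultilinearMap.hasFDerivAt (detCols n) _).comp u (hasFDerivAt_pi.2 h)

/-- The rows of the cofactor matrix of a Jacobian are divergence free. -/
theorem sum_fderiv_adjugate_jacobian {γ : (n → ℝ) → n → ℂ} (hγ : ContDiff ℝ ∞ γ) (u : n → ℝ)
    (p : n) :
    ∑ q, fderiv ℝ (fun u => (jacobian γ u).adjugate q p) u (Pi.single q 1) = 0 := by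
  set c : n → n → ℂ := fun r => fderiv ℝ γ u (Pi.single r 1) with hc
  set e : n → ℂ := Pi.single p 1 with he
  set H : n → n → n → ℂ := fun q r => fderiv ℝ (fderiv ℝ γ) u (Pi.single q 1) (Pi.single r 1)
    with hH
  have hsymm : ∀ q r, H q r = H r q := fun q r =>
    (hγ.contDiffAt.isSymmSndFDerivAt (by simpa using ENat.LEInfty.out)).eq _ _
  -- The contribution to the `q`-th derivative in which the product rule hits the partial derivative
  -- with index `r`; slot `q` holds a constant vector.
  set t : n → n → ℂ := fun q r => if r = q then 0 else
    detCols n (Function.update (Function.update c q e) r (H q r)) with ht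
  have h1 : ∀ q, fderiv ℝ (fun u => (jacobian γ u).adjugate q p) u (Pi.single q 1) =
      ∑ r, t q r := by
    intro q
    rw [(hasFDerivAt_adjugate_jacobian hγ u p q).fderiv, ContinuousLinearMap.comp_apply,
      ContinuousMultilinearMap.linearDeriv_apply]
    refine Finset.sum_congr rfl fun r _ => ?_
    by_cases hr : r = q
    · subst hr
      simp only [ht, if_true, ContinuousLinearMap.coe_pi', zero_apply]
      exact (detCols n).map_coord_zero r (by simp)
    · simp [ht, hr, hH, hc, he]
  -- The Hessian is symmetric and the determinant alternating, so the double sum is its own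
  -- negative.
  have h2 : ∀ q r, t q r = -t r q := by
    intro q r
    by_cases hr : r = q
    · simp [ht, hr]
    · simp only [ht, if_neg hr, if_neg (Ne.symm hr)]
      rw [hsymm q r, detCols_update_update_swap c e _ (Ne.symm hr), neg_neg]
  have h3 : ∑ q, ∑ r, t q r = -∑ q, ∑ r, t q r := by
    conv_lhs => rw [Finset.sum_comm]
    rw [← Finset.sum_neg_distrib]
    refine Finset.sum_congr rfl fun q _ => ?_
    rw [← Finset.sum_neg_distrib]
    exact Finset.sum_congr rfl fun r _ => h2 r q
  rw [Finset.sum_congr rfl fun q _ => h1 q]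
  exact self_eq_neg.1 h3

lemma det_updateRow_eq_sum_adjugate (A : Matrix n n ℂ) (p : n) (b : n → ℂ) :
    (A.updateRow p b).det = ∑ q, b q * A.adjugate q p := by
  rw [← Matrix.cramer_transpose_apply, Matrix.cramer_eq_adjugate_mulVec, ← Matrix.adjugate_transpose]
  simp [Matrix.mulVec, dotProduct, mul_comm]

lemma contDiff_adjugate_jacobian {γ : (n → ℝ) → n → ℂ} (hγ : ContDiff ℝ ∞ γ) (p q : n) :
    ContDiff ℝ ∞ (fun u => (jacobian γ u).adjugate q p) := by
  simp only [adjugate_jacobian_apply]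
  refine (detCols n).contDiff.comp ?_
  refine contDiff_pi.2 fun r => ?_
  by_cases hr : r = q
  · subst hr
    simpa using contDiff_const
  · simp only [Function.update_of_ne hr]
    exact (hγ.fderiv_right (m := ∞) (by simp)).clm_apply contDiff_const

lemma continuous_jacobian {γ : (n → ℝ) → n → ℂ} (hγ : ContDiff ℝ ∞ γ) :
    Continuous (jacobian γ) := by
  refine continuous_matrix fun p q => ?_
  have := (hγ.fderiv_right (m := ∞) (by simp)).continuous
  simp only [jacobian, Matrix.of_apply]
  fun_prop

/-- A Jacobian determinant with one compactly supported component integrates to zero. -/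
theorem integral_det_updateRow_fderiv_eq_zero {γ : (n → ℝ) → n → ℂ} (hγ : ContDiff ℝ ∞ γ)
    {w : (n → ℝ) → ℂ} (hw : ContDiff ℝ 1 w) (hws : HasCompactSupport w) (p : n) :
    ∫ u, ((jacobian γ u).updateRow p fun q => fderiv ℝ w u (Pi.single q 1)).det = 0 := by
  have hadj := fun q => contDiff_adjugate_jacobian hγ p q
  have hw' : Continuous (fderiv ℝ w) := hw.continuous_fderiv (by simp)
  have hadj' := fun q => (hadj q).continuous_fderiv (by simp)
  have hc1 : ∀ q, Integrable fun u =>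
      (jacobian γ u).adjugate q p * fderiv ℝ w u (Pi.single q 1) := fun q =>
    ((hadj q).continuous.mul (by fun_prop)).integrable_of_hasCompactSupport
      ((hws.fderiv_apply (𝕜 := ℝ) _).mul_left)
  have hc2 : ∀ q, Integrable fun u =>
      fderiv ℝ (fun u => (jacobian γ u).adjugate q p) u (Pi.single q 1) * w u := fun q =>
    (((hadj' q).clm_apply continuous_const).mul hw.continuous).integrable_of_hasCompactSupport
      hws.mul_left
  have hc3 : ∀ q, Integrable fun u => (jacobian γ u).adjugate q p * w u := fun q =>
    ((hadj q).continuous.mul hw.continuous).integrable_of_hasCompactSupport hws.mul_left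
  -- Integration by parts moves all derivatives onto the cofactors, whose divergence vanishes.
  have hibp : ∀ q, ∫ u, (jacobian γ u).adjugate q p * fderiv ℝ w u (Pi.single q 1) =
      -∫ u, fderiv ℝ (fun u => (jacobian γ u).adjugate q p) u (Pi.single q 1) * w u := fun q =>
    integral_mul_fderiv_eq_neg_fderiv_mul_of_integrable (hc2 q) (hc1 q) (hc3 q)
      (fun x _ => (hadj q).differentiable (by simp) x)
      (fun x _ => hw.differentiable (by simp) x)
  simp only [det_updateRow_eq_sum_adjugate, mul_comm (fderiv ℝ w _ _)]
  rw [integral_finsetSum _ fun q _ => hc1 q, Finset.sum_congr rfl fun q _ => hibp q,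
    Finset.sum_neg_distrib, ← integral_finsetSum _ fun q _ => hc2 q]
  simp only [← Finset.sum_mul, sum_fderiv_adjugate_jacobian hγ, zero_mul, integral_zero, neg_zero]

end NullLagrangian

/-! ### Cutoffs with small gradient. -/

section Cutoff

/-- Rescalings $b(T/(k+1))$ of a single bump: the chain rule supplies the factor $1/(k+1)$ that
later kills the error term in Stokes' theorem. -/
lemma exists_cutoff (E : Type*) [NormedAddCommGroup E] [NormedSpace ℝ E] [FiniteDimensional ℝ E] :
    ∃ χ : ℕ → E → ℝ, (∀ k, ContDiff ℝ ∞ (χ k)) ∧ (∀ k, HasCompactSupport (χ k)) ∧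
      (∀ k T, |χ k T| ≤ 1) ∧ (∀ T, ∀ᶠ k in atTop, χ k T = 1) ∧
      ∃ M : ℝ, 0 < M ∧ ∀ k T, ‖fderiv ℝ (χ k) T‖ ≤ M / ((k : ℝ) + 1) := by
  obtain ⟨b⟩ : Nonempty (ContDiffBump (0 : E)) := ⟨default⟩
  have hb : ContDiff ℝ ∞ b := b.contDiff
  have hbd : Differentiable ℝ b := hb.differentiable (by simp)
  have hc : ∀ k : ℕ, ((k : ℝ) + 1)⁻¹ ≠ 0 := fun k => by positivity
  refine ⟨fun k T => b (((k : ℝ) + 1)⁻¹ • T), fun k => hb.comp (contDiff_const_smul _),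
    fun k => b.hasCompactSupport.comp_smul (hc k), fun k T => ?_, fun T => ?_, ?_⟩
  · rw [abs_of_nonneg b.nonneg]; exact b.le_one
  · have h : Tendsto (fun k : ℕ => ((k : ℝ) + 1)⁻¹ • T) atTop (nhds 0) := by
      have h1 : Tendsto (fun k : ℕ => ((k : ℝ) + 1)⁻¹) atTop (nhds 0) := by
        simpa [one_div] using tendsto_one_div_add_atTop_nhds_zero_nat (𝕜 := ℝ)
      simpa using h1.smul_const T
    filter_upwards [h (Metric.closedBall_mem_nhds 0 b.rIn_pos)] with k hk
    exact b.one_of_mem_closedBall hk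
  · obtain ⟨M, hM⟩ := (b.hasCompactSupport.fderiv (𝕜 := ℝ)).exists_bound_of_continuous
      (hb.continuous_fderiv (by simp))
    refine ⟨|M| + 1, by positivity, fun k T => ?_⟩
    have h : HasFDerivAt (fun T : E => b (((k : ℝ) + 1)⁻¹ • T))
        ((fderiv ℝ b (((k : ℝ) + 1)⁻¹ • T)).comp
          (((k : ℝ) + 1)⁻¹ • ContinuousLinearMap.id ℝ E)) T :=
      (hbd _).hasFDerivAt.comp T ((hasFDerivAt_id T).const_smul _)
    rw [h.fderiv, ContinuousLinearMap.comp_smul, ContinuousLinearMap.comp_id, norm_smul,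
      Real.norm_of_nonneg (by positivity), div_eq_inv_mul]
    gcongr
    exact (hM _).trans ((le_abs_self M).trans (by linarith))

end Cutoff

/-! ### A primitive along a translation. -/

section Primitive

variable {n : Type*} [Fintype n]

/-- The average of a holomorphic function over a segment of translates is holomorphic, and its
derivative along the segment is the difference of the function at the endpoints. -/
theorem contDiff_segment_average {F : (n → ℂ) → ℂ} (hF : ContDiff ℂ 1 F) (v : n → ℂ) :
    ContDiff ℂ 1 (fun T => ∫ t in (0 : ℝ)..1, F (T + t • v)) ∧
    ∀ T, fderiv ℂ (fun T => ∫ t in (0 : ℝ)..1, F (T + t • v)) T v = F (T + v) - F T := by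
  have hF' : Continuous (fderiv ℂ F) := hF.continuous_fderiv (by simp)
  have hFd : Differentiable ℂ F := hF.differentiable (by simp)
  have hcont : Continuous fun z : (n → ℂ) × ℝ => fderiv ℂ F (z.1 + z.2 • v) := by fun_prop
  have hd : ∀ T, HasFDerivAt (fun T => ∫ t in (0 : ℝ)..1, F (T + t • v))
      (∫ t in (0 : ℝ)..1, fderiv ℂ F (T + t • v)) T := by
    intro T
    obtain ⟨C, hC⟩ := ((isCompact_closedBall T 1).prod
      (isCompact_Icc (a := (0 : ℝ)) (b := 1))).exists_bound_of_continuousOn hcont.continuousOn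
    refine intervalIntegral.hasFDerivAt_integral_of_dominated_of_fderiv_le
      (F := fun T t => F (T + t • v)) (F' := fun T t => fderiv ℂ F (T + t • v))
      (s := Metric.closedBall T 1) (bound := fun _ => C)
      (Metric.closedBall_mem_nhds T one_pos) ?_ ?_ ?_ ?_ ?_ ?_
    · refine Eventually.of_forall fun S => Continuous.aestronglyMeasurable ?_
      have := hFd.continuous
      fun_prop
    · refine Continuous.intervalIntegrable ?_ _ _
      have := hFd.continuous
      fun_prop
    · exact Continuous.aestronglyMeasurable (by fun_prop)
    · refine Eventually.of_forall fun t ht S hS => hC (S, t) ⟨hS, ?_⟩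
      rw [Set.uIoc_of_le zero_le_one] at ht
      exact ⟨ht.1.le, ht.2⟩
    · exact intervalIntegrable_const
    · refine Eventually.of_forall fun t _ S _ => ?_
      have h := (hFd (S + t • v)).hasFDerivAt.comp S ((hasFDerivAt_id S).add_const (t • v))
      rw [ContinuousLinearMap.comp_id] at h
      exact h
  have hfd : (fderiv ℂ fun T => ∫ t in (0 : ℝ)..1, F (T + t • v)) =
      fun T => ∫ t in (0 : ℝ)..1, fderiv ℂ F (T + t • v) := funext fun T => (hd T).fderiv
  refine ⟨contDiff_one_iff_fderiv.2 ⟨fun T => (hd T).differentiableAt, ?_⟩, fun T => ?_⟩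
  · rw [hfd]
    exact intervalIntegral.continuous_parametric_intervalIntegral_of_continuous' hcont _ _
  · rw [hfd]
    have hint : IntervalIntegrable (fun t : ℝ => fderiv ℂ F (T + t • v)) volume 0 1 :=
      Continuous.intervalIntegrable (by fun_prop) _ _
    beta_reduce
    rw [ContinuousLinearMap.intervalIntegral_apply hint]
    -- The averaged directional derivative is the integral of a total derivative in `t`.
    have hderiv : ∀ t : ℝ, HasDerivAt (fun t : ℝ => F (T + t • v))
        (fderiv ℂ F (T + t • v) v) t := by
      intro t
      have h1 : HasDerivAt (fun t : ℝ => T + t • v) v t := by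
        simpa using ((hasDerivAt_id t).smul_const v).const_add T
      exact ((hFd (T + t • v)).hasFDerivAt.restrictScalars ℝ).comp_hasDerivAt t h1
    rw [intervalIntegral.integral_eq_sub_of_hasDerivAt (fun t _ => hderiv t)
      (Continuous.intervalIntegrable (by fun_prop) _ _)]
    simp

end Primitive

/-! ### Stokes' theorem with a cutoff. -/

section Stokes

variable {n : Type*} [Fintype n] [DecidableEq n]

/-- Putting row `r ≠ p` in place of row `p` repeats a row, so only the coefficient `c p` survives.
This is where holomorphy pays off: the differential of a holomorphic function is such a complex
combination of the rows of the Jacobian. -/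
lemma det_updateRow_linear_combination (A : Matrix n n ℂ) (p : n) (a b : ℂ) (c e : n → ℂ) :
    (A.updateRow p fun q => a * (∑ r, c r * A r q) + b * e q).det =
      a * (c p * A.det) + b * (A.updateRow p e).det := by
  have h1 : (fun q => a * (∑ r, c r * A r q) + b * e q) =
      a • (∑ r, c r • A r) + b • e := by
    ext q; simp
  rw [h1, Matrix.det_updateRow_add, Matrix.det_updateRow_smul, Matrix.det_updateRow_smul,
    Matrix.det_updateRow_sum, smul_eq_mul]

/-- The point where properness of the contour is used: cutoffs in the target pull back to cutoffs in
the parameters. -/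
lemma hasCompactSupport_comp_of_tendsto_cocompact {X Y R : Type*} [TopologicalSpace X] [R1Space X]
    [TopologicalSpace Y] [T2Space Y] [Zero R] {γ : X → Y} (hγ : Continuous γ)
    (hp : Tendsto γ (cocompact X) (cocompact Y)) {f : Y → R} (hf : HasCompactSupport f) :
    HasCompactSupport (f ∘ γ) := by
  have h1 : γ ⁻¹' (tsupport f)ᶜ ∈ cocompact X := hp (hf.isCompact.compl_mem_cocompact)
  obtain ⟨K, hK, hKs⟩ := mem_cocompact.1 h1
  refine HasCompactSupport.of_support_subset_isCompact
    (hK.of_isClosed_subset ((isClosed_tsupport f).preimage hγ) ?_)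
    (fun x hx => subset_tsupport f hx)
  intro x hx
  by_contra h
  exact hKs h hx

variable {γ : (n → ℝ) → n → ℂ}

/-- Stokes' theorem for the form `χ P ι_v dT` on a properly embedded chain without boundary. -/
theorem integral_cutoff_mul_fderiv (hγ : ContDiff ℝ ∞ γ)
    (hp : Tendsto γ (cocompact (n → ℝ)) (cocompact (n → ℂ))) {χ : (n → ℂ) → ℝ}
    (hχ : ContDiff ℝ ∞ χ) (hχs : HasCompactSupport χ) {P : (n → ℂ) → ℂ} (hP : ContDiff ℂ 1 P)
    (v : n → ℂ) :
    ∫ u, (χ (γ u) : ℂ) * (fderiv ℂ P (γ u) v * (jacobian γ u).det) =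
      -∫ u, P (γ u) * ∑ p, v p * ((jacobian γ u).updateRow p fun q =>
        (fderiv ℝ χ (γ u) fun r => jacobian γ u r q : ℂ)).det := by
  have hγd : Differentiable ℝ γ := hγ.differentiable (by simp)
  have hχd : Differentiable ℝ χ := hχ.differentiable (by simp)
  have hPd : Differentiable ℂ P := hP.differentiable (by simp)
  have hPR : ContDiff ℝ 1 P := hP.restrict_scalars ℝ
  have hP' : Continuous (fderiv ℂ P) := hP.continuous_fderiv (by simp)
  have hχ' : Continuous (fderiv ℝ χ) := hχ.continuous_fderiv (by simp)
  have hJ := continuous_jacobian hγ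
  have hγc := hγd.continuous
  have hχc := hχd.continuous
  have hPc := hPd.continuous
  have hJpq : ∀ p q, Continuous fun u => jacobian γ u p q := fun p q => hJ.matrix_elem p q
  set w : (n → ℝ) → ℂ := fun u => (χ (γ u) : ℂ) * P (γ u) with hw
  have hw1 : ContDiff ℝ 1 w := by
    refine ContDiff.mul ?_ ?_
    · exact (Complex.ofRealCLM.contDiff.comp (hχ.of_le (by simp))).comp (hγ.of_le (by simp))
    · exact hPR.comp (hγ.of_le (by simp))
  have hχγ : HasCompactSupport fun u => (χ (γ u) : ℂ) :=
    (hasCompactSupport_comp_of_tendsto_cocompact hγc hp hχs).comp_left (g := Complex.ofReal)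
      Complex.ofReal_zero
  have hws : HasCompactSupport w := hχγ.mul_right
  -- Product rule for $\chi P$: the part with $dP$ is a complex combination of Jacobian rows, while
  -- $\chi$ is only real-smooth and its differential stays as a real covector.
  have hdw : ∀ u q, fderiv ℝ w u (Pi.single q 1) =
      (χ (γ u) : ℂ) * (∑ r, fderiv ℂ P (γ u) (Pi.single r 1) * jacobian γ u r q) +
        P (γ u) * (fderiv ℝ χ (γ u) fun r => jacobian γ u r q : ℂ) := by
    intro u q
    have h1 : HasFDerivAt (fun u => (χ (γ u) : ℂ))
        (Complex.ofRealCLM.comp ((fderiv ℝ χ (γ u)).comp (fderiv ℝ γ u))) u :=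
      Complex.ofRealCLM.hasFDerivAt.comp u
        ((hχd (γ u)).hasFDerivAt.comp u (hγd u).hasFDerivAt)
    have h2 : HasFDerivAt (fun u => P (γ u))
        (((fderiv ℂ P (γ u)).restrictScalars ℝ).comp (fderiv ℝ γ u)) u :=
      ((hPd (γ u)).hasFDerivAt.restrictScalars ℝ).comp u (hγd u).hasFDerivAt
    have h3 : fderiv ℝ γ u (Pi.single q 1) =
        ∑ r, jacobian γ u r q • (Pi.single r 1 : n → ℂ) := by
      ext s
      simp [jacobian, Finset.sum_apply, Pi.single_apply]
    have h4 : (fun r => jacobian γ u r q) = fderiv ℝ γ u (Pi.single q 1) := rfl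
    have h5 : fderiv ℂ P (γ u) (fderiv ℝ γ u (Pi.single q 1)) =
        ∑ r, fderiv ℂ P (γ u) (Pi.single r 1) * jacobian γ u r q := by
      rw [h3, map_sum]
      simp [mul_comm]
    have h6 : fderiv ℝ w u = _ := (h1.mul h2).fderiv
    rw [h6, h4, ← h5]
    simp
  have hzero := fun p => integral_det_updateRow_fderiv_eq_zero hγ hw1 hws p
  simp only [hdw, det_updateRow_linear_combination] at hzero
  have hsupp2 : HasCompactSupport fun u => fderiv ℝ χ (γ u) :=
    hasCompactSupport_comp_of_tendsto_cocompact hγc hp (hχs.fderiv (𝕜 := ℝ))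
  have hi1 : ∀ p, Integrable fun u =>
      (χ (γ u) : ℂ) * (fderiv ℂ P (γ u) (Pi.single p 1) * (jacobian γ u).det) := by
    intro p
    refine Continuous.integrable_of_hasCompactSupport ?_ hχγ.mul_right
    fun_prop
  have hi2 : ∀ p, Integrable fun u => P (γ u) * ((jacobian γ u).updateRow p fun q =>
        (fderiv ℝ χ (γ u) fun r => jacobian γ u r q : ℂ)).det := by
    intro p
    refine Continuous.integrable_of_hasCompactSupport ?_ ?_
    · refine (hPc.comp hγc).mul (Continuous.matrix_det ?_)
      refine hJ.matrix_updateRow p (continuous_pi fun q => Complex.continuous_ofReal.comp ?_)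
      exact (hχ'.comp hγc).clm_apply (continuous_pi fun r => hJpq r q)
    · refine HasCompactSupport.mul_left (hsupp2.mono ?_)
      intro u hu h0
      change fderiv ℝ χ (γ u) = 0 at h0
      refine hu ?_
      refine Matrix.det_eq_zero_of_row_eq_zero p fun q => ?_
      rw [Matrix.updateRow_self, h0]
      simp
  have hsplit : ∀ p, ∫ u, (χ (γ u) : ℂ) *
        (fderiv ℂ P (γ u) (Pi.single p 1) * (jacobian γ u).det) =
      -∫ u, P (γ u) * ((jacobian γ u).updateRow p fun q =>
        (fderiv ℝ χ (γ u) fun r => jacobian γ u r q : ℂ)).det := by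
    intro p
    have := hzero p
    rw [integral_add (hi1 p) (hi2 p)] at this
    exact eq_neg_of_add_eq_zero_left this
  have hv : ∀ u, fderiv ℂ P (γ u) v = ∑ p, v p * fderiv ℂ P (γ u) (Pi.single p 1) := by
    intro u
    have h3 : v = ∑ p, v p • (Pi.single p 1 : n → ℂ) := by
      ext s
      simp [Finset.sum_apply, Pi.single_apply]
    conv_lhs => rw [h3, map_sum]
    simp
  have e1 : ∀ u, (χ (γ u) : ℂ) * (fderiv ℂ P (γ u) v * (jacobian γ u).det) =
      ∑ p, v p * ((χ (γ u) : ℂ) *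
        (fderiv ℂ P (γ u) (Pi.single p 1) * (jacobian γ u).det)) := by
    intro u
    rw [hv, Finset.sum_mul, Finset.mul_sum]
    exact Finset.sum_congr rfl fun p _ => by ring
  have e2 : ∀ u, P (γ u) * ∑ p, v p * ((jacobian γ u).updateRow p fun q =>
        (fderiv ℝ χ (γ u) fun r => jacobian γ u r q : ℂ)).det =
      ∑ p, v p * (P (γ u) * ((jacobian γ u).updateRow p fun q =>
        (fderiv ℝ χ (γ u) fun r => jacobian γ u r q : ℂ)).det) := by
    intro u
    rw [Finset.mul_sum]
    exact Finset.sum_congr rfl fun p _ => by ring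
  simp only [e1, e2]
  rw [integral_finsetSum _ fun p _ => (hi1 p).const_mul _,
    integral_finsetSum _ fun p _ => (hi2 p).const_mul _, ← Finset.sum_neg_distrib]
  refine Finset.sum_congr rfl fun p _ => ?_
  rw [integral_const_mul, integral_const_mul, hsplit p, mul_neg]

end Stokes

/-! ### Translation invariance of contour integrals. -/

section Translation

lemma norm_proj_le_one {n : Type*} [Fintype n] (p : n) :
    ‖(ContinuousLinearMap.proj p : (n → ℂ) →L[ℝ] ℂ)‖ ≤ 1 :=
  ContinuousLinearMap.opNorm_le_bound _ zero_le_one fun x => by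
    simpa using norm_le_pi_norm x p

variable {n : Type*} [Fintype n] [DecidableEq n]

/-- The Riemannian volume of the parallelotope spanned by the columns of a complex matrix. -/
noncomputable def gramVol (A : Matrix n n ℂ) : ℝ :=
  Real.sqrt (Matrix.det ((A.conjTranspose * A).map Complex.re))

lemma gramVol_nonneg (A : Matrix n n ℂ) : 0 ≤ gramVol A := Real.sqrt_nonneg _

lemma norm_det_le_gramVol (A : Matrix n n ℂ) :
    ‖A.det‖ ≤ (Fintype.card n).factorial * gramVol A :=
  norm_det_le_factorial_mul_sqrt_gram A (fun p => ContinuousLinearMap.proj p) norm_proj_le_one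

/-- Rescaling `l` by `c⁻¹` reduces to forms of norm at most one. The linear dependence on `c`
matters, since `c` will be the gradient bound of the cutoff. -/
lemma norm_det_updateRow_le_gramVol (A : Matrix n n ℂ) (p : n) (l : (n → ℂ) →L[ℝ] ℝ) {c : ℝ}
    (hc : 0 < c) (hl : ‖l‖ ≤ c) :
    ‖(A.updateRow p fun q => (l fun r => A r q : ℂ)).det‖ ≤
      c * ((Fintype.card n).factorial * gramVol A) := by
  set l' : (n → ℂ) →L[ℝ] ℂ := Complex.ofRealCLM.comp (c⁻¹ • l) with hl'
  have hn : ‖l'‖ ≤ 1 := by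
    refine ContinuousLinearMap.opNorm_le_bound _ zero_le_one fun x => ?_
    have h1 : ‖l x‖ ≤ c * ‖x‖ := l.le_of_opNorm_le hl x
    simp only [hl', ContinuousLinearMap.comp_apply, Complex.ofRealCLM_apply, smul_apply,
      smul_eq_mul, Complex.norm_real, norm_mul, norm_inv, one_mul, Real.norm_of_nonneg hc.le]
    rw [inv_mul_le_iff₀ hc]
    exact h1
  have h := norm_det_le_factorial_mul_sqrt_gram A
    (Function.update (fun p => ContinuousLinearMap.proj p) p l') (fun q => by
      rcases eq_or_ne q p with rfl | hq
      · simpa using hn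
      · simpa [hq] using norm_proj_le_one q)
  have h2 : (A.updateRow p fun q => (l fun r => A r q : ℂ)) =
      A.updateRow p ((c : ℂ) • fun q => l' fun r => A r q) := by
    congr 1
    ext q
    have : (c : ℂ) ≠ 0 := by exact_mod_cast hc.ne'
    simp [hl', this]
  have h3 : (Matrix.of fun s q =>
      (Function.update (fun p => (ContinuousLinearMap.proj p : (n → ℂ) →L[ℝ] ℂ)) p l') s
        (fun r => A r q)) = A.updateRow p fun q => l' fun r => A r q := by
    ext s q
    rcases eq_or_ne s p with rfl | hs
    · simp
    · simp [hs]
  rw [h3] at h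
  rw [h2, Matrix.det_updateRow_smul, norm_mul, Complex.norm_real, Real.norm_of_nonneg hc.le]
  exact mul_le_mul_of_nonneg_left h hc.le

lemma continuous_gramVol_jacobian {γ : (n → ℝ) → n → ℂ} (hγ : ContDiff ℝ ∞ γ) :
    Continuous fun u => gramVol (jacobian γ u) := by
  have hJ := continuous_jacobian hγ
  exact Real.continuous_sqrt.comp
    ((hJ.matrix_conjTranspose.matrix_mul hJ).matrix_map Complex.continuous_re).matrix_det

/-- Invariance of the integral of a holomorphic form of top degree over a properly embedded chain
without boundary under translations, provided that the integrals over the intermediate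
translates are dominated. -/
theorem integral_comp_add_mul_det_jacobian {γ : (n → ℝ) → n → ℂ} (hγ : ContDiff ℝ ∞ γ)
    (hp : Tendsto γ (cocompact (n → ℝ)) (cocompact (n → ℂ))) {F : (n → ℂ) → ℂ}
    (hF : ContDiff ℂ 1 F) (v : n → ℂ) {g : (n → ℝ) → ℝ} (hg : Integrable g)
    (hb : ∀ t ∈ Set.Icc (0 : ℝ) 1, ∀ u,
      ‖F (γ u + t • v)‖ * gramVol (jacobian γ u) ≤ g u) :
    ∫ u, F (γ u + v) * (jacobian γ u).det = ∫ u, F (γ u) * (jacobian γ u).det := by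
  obtain ⟨hP, hPv⟩ := contDiff_segment_average hF v
  set P : (n → ℂ) → ℂ := fun T => ∫ t in (0 : ℝ)..1, F (T + t • v) with hPdef
  obtain ⟨χ, hχ, hχs, hχ1, hχlim, M, hM, hχ'⟩ := exists_cutoff (n → ℂ)
  set D : ℝ := ((Fintype.card n).factorial : ℝ) with hD
  have hD0 : 0 ≤ D := by positivity
  have hJ := continuous_jacobian hγ
  have hγc := hγ.continuous
  have hFc := hF.continuous
  have hdet : ∀ u, ‖(jacobian γ u).det‖ ≤ D * gramVol (jacobian γ u) := fun u =>
    norm_det_le_gramVol _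
  have hFdet : ∀ t ∈ Set.Icc (0 : ℝ) 1, ∀ u,
      ‖F (γ u + t • v) * (jacobian γ u).det‖ ≤ D * g u := by
    intro t ht u
    rw [norm_mul]
    calc _ ≤ ‖F (γ u + t • v)‖ * (D * gramVol (jacobian γ u)) := by gcongr; exact hdet u
      _ = D * (‖F (γ u + t • v)‖ * gramVol (jacobian γ u)) := by ring
      _ ≤ _ := by gcongr; exact hb t ht u
  have h0 := hFdet 0 (by simp)
  have h1 := hFdet 1 (by simp)
  simp only [zero_smul, add_zero, one_smul] at h0 h1
  have hi0 : Integrable fun u => F (γ u) * (jacobian γ u).det :=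
    (hg.const_mul D).mono' (by fun_prop) (Eventually.of_forall h0)
  have hi1 : Integrable fun u => F (γ u + v) * (jacobian γ u).det :=
    (hg.const_mul D).mono' (by fun_prop) (Eventually.of_forall h1)
  set d : (n → ℝ) → ℂ := fun u => (F (γ u + v) - F (γ u)) * (jacobian γ u).det with hd
  have hdi : Integrable d := by
    refine (hi1.sub hi0).congr (Eventually.of_forall fun u => ?_)
    simp [hd, sub_mul]
  -- The same cut-off integrals have two limits: the full difference by dominated convergence, and
  -- zero by Stokes' theorem.
  have hlim1 : Tendsto (fun k => ∫ u, (χ k (γ u) : ℂ) * d u) atTop (nhds (∫ u, d u)) := by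
    refine tendsto_integral_of_dominated_convergence (fun u => ‖d u‖) (fun k => ?_) hdi.norm
      (fun k => Eventually.of_forall fun u => ?_) (Eventually.of_forall fun u => ?_)
    · have := (hχ k).continuous
      refine Continuous.aestronglyMeasurable ?_
      fun_prop
    · rw [norm_mul, Complex.norm_real, Real.norm_eq_abs]
      exact mul_le_of_le_one_left (norm_nonneg _) (hχ1 k _)
    · refine tendsto_const_nhds.congr' ?_
      filter_upwards [hχlim (γ u)] with k hk
      simp [hk]
  -- Domination on every intermediate translate passes to the average; this is why control at the
  -- two endpoints alone does not suffice here.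
  have hPbound : ∀ u, ‖P (γ u)‖ * gramVol (jacobian γ u) ≤ g u := by
    intro u
    have hV := gramVol_nonneg (jacobian γ u)
    have h : ‖∫ t in (0 : ℝ)..1, (gramVol (jacobian γ u) : ℂ) * F (γ u + t • v)‖ ≤
        g u * |1 - 0| := by
      refine intervalIntegral.norm_integral_le_of_norm_le_const fun t ht => ?_
      rw [Set.uIoc_of_le zero_le_one] at ht
      rw [norm_mul, Complex.norm_real, Real.norm_of_nonneg hV, mul_comm]
      exact hb t ⟨ht.1.le, ht.2⟩ u
    rw [intervalIntegral.integral_const_mul, norm_mul, Complex.norm_real,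
      Real.norm_of_nonneg hV] at h
    simpa [mul_comm] using h
  set V : ℝ := ∑ p, ‖v p‖ with hV
  have hlim2 : Tendsto (fun k => ∫ u, (χ k (γ u) : ℂ) * d u) atTop (nhds 0) := by
    have hbound : ∀ k, ‖∫ u, (χ k (γ u) : ℂ) * d u‖ ≤
        (V * M * D * ∫ u, g u) * (1 / ((k : ℝ) + 1)) := by
      intro k
      have hs := integral_cutoff_mul_fderiv hγ hp (hχ k) (hχs k) hP v
      simp only [hPv] at hs
      rw [hs, norm_neg]
      have hg' : Integrable fun u => (V * (M / ((k : ℝ) + 1)) * D) * g u := hg.const_mul _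
      refine (norm_integral_le_of_norm_le hg' (Eventually.of_forall fun u => ?_)).trans
        (le_of_eq ?_)
      · have hMk : 0 < M / ((k : ℝ) + 1) := by positivity
        rw [norm_mul]
        have hsum : ‖∑ p, v p * ((jacobian γ u).updateRow p fun q =>
            (fderiv ℝ (χ k) (γ u) fun r => jacobian γ u r q : ℂ)).det‖ ≤
            V * (M / ((k : ℝ) + 1) * (D * gramVol (jacobian γ u))) := by
          refine (norm_sum_le _ _).trans ?_
          rw [hV, Finset.sum_mul]
          refine Finset.sum_le_sum fun p _ => ?_
          rw [norm_mul]
          exact mul_le_mul_of_nonneg_left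
            (norm_det_updateRow_le_gramVol _ p _ hMk (hχ' k _)) (norm_nonneg _)
        have hV0 : 0 ≤ V := Finset.sum_nonneg fun p _ => norm_nonneg _
        calc _ ≤ ‖P (γ u)‖ * (V * (M / ((k : ℝ) + 1) * (D * gramVol (jacobian γ u)))) := by
              gcongr
          _ = (V * (M / ((k : ℝ) + 1)) * D) * (‖P (γ u)‖ * gramVol (jacobian γ u)) := by ring
          _ ≤ _ := by gcongr; exact hPbound u
      · rw [integral_const_mul]; ring
    refine squeeze_zero_norm hbound ?_
    simpa using (tendsto_one_div_add_atTop_nhds_zero_nat (𝕜 := ℝ)).const_mul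
      (V * M * D * ∫ u, g u)
  have hfin : ∫ u, d u = 0 := tendsto_nhds_unique hlim1 hlim2
  have : ∫ u, d u = (∫ u, F (γ u + v) * (jacobian γ u).det) -
      ∫ u, F (γ u) * (jacobian γ u).det := by
    rw [← integral_sub hi1 hi0]
    simp only [hd, sub_mul]
  rw [hfin] at this
  exact (sub_eq_zero.1 this.symm)

end Translation

/-! ### Telescoping, reindexing of the triangle, and Abel summation. -/

section Sums

variable {M : Type*} [AddCommGroup M]

lemma sum_Icc_one_sub_pred (h : ℕ → M) (k : ℕ) :
    ∑ n ∈ Finset.Icc 1 k, (h n - h (n - 1)) = h k - h 0 := by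
  induction k with
  | zero => simp
  | succ k ih => rw [Finset.sum_Icc_succ_top (by omega), ih]; simp

lemma sum_Icc_succ_sub (h : ℕ → M) {i n : ℕ} (hin : i ≤ n) :
    ∑ k ∈ Finset.Icc i n, (h (k + 1) - h k) = h (n + 1) - h i := by
  induction n, hin using Nat.le_induction with
  | base => simp
  | succ n hn ih => rw [Finset.sum_Icc_succ_top (by omega), ih]; simp

lemma sum_Idx {M : Type*} [AddCommMonoid M] (N : ℕ) (g : ℕ → ℕ → M) :
    ∑ p : Idx N, g p.1.1 p.1.2 =
      ∑ k ∈ Finset.Icc 1 (N - 1), ∑ i ∈ Finset.Icc 1 k, g k i := by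
  rw [Finset.sum_coe_sort ((Finset.range N ×ˢ Finset.range N).filter
    (fun p => 1 ≤ p.2 ∧ p.2 ≤ p.1)) (fun p => g p.1 p.2), Finset.sum_sigma']
  refine Finset.sum_bij' (fun p _ => (⟨p.1, p.2⟩ : (_ : ℕ) × ℕ)) (fun p _ => (p.1, p.2))
    ?_ ?_ ?_ ?_ ?_ <;> simp <;> omega

lemma sum_Idx_columns {M : Type*} [AddCommMonoid M] (N : ℕ) (g : ℕ → ℕ → M) :
    ∑ p : Idx N, g p.1.1 p.1.2 =
      ∑ i ∈ Finset.Icc 1 N, ∑ k ∈ Finset.Icc i (N - 1), g k i := by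
  rw [Finset.sum_coe_sort ((Finset.range N ×ˢ Finset.range N).filter
    (fun p => 1 ≤ p.2 ∧ p.2 ≤ p.1)) (fun p => g p.1 p.2), Finset.sum_sigma']
  refine Finset.sum_bij' (fun p _ => (⟨p.2, p.1⟩ : (_ : ℕ) × ℕ)) (fun p _ => (p.2, p.1))
    ?_ ?_ ?_ ?_ ?_ <;> simp <;> omega

lemma sum_Idx_columns_pred {M : Type*} [AddCommMonoid M] (N : ℕ) (g : ℕ → ℕ → M) :
    ∑ p : Idx N, g p.1.1 p.1.2 =
      ∑ i ∈ Finset.Icc 1 (N - 1), ∑ k ∈ Finset.Icc i (N - 1), g k i := by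
  rw [Finset.sum_coe_sort ((Finset.range N ×ˢ Finset.range N).filter
    (fun p => 1 ≤ p.2 ∧ p.2 ≤ p.1)) (fun p => g p.1 p.2), Finset.sum_sigma']
  refine Finset.sum_bij' (fun p _ => (⟨p.2, p.1⟩ : (_ : ℕ) × ℕ)) (fun p _ => (p.2, p.1))
    ?_ ?_ ?_ ?_ ?_ <;> simp <;> omega

/-- Groups by $j=N+i-k$, the index of the second entry of $x$ in the Cartan translation. -/
lemma sum_Idx_antidiagonals {M : Type*} [AddCommMonoid M] (N : ℕ) (g : ℕ → ℕ → M) :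
    ∑ p : Idx N, g p.1.1 p.1.2 =
      ∑ j ∈ Finset.Icc 1 N, ∑ k ∈ Finset.Icc 1 (j - 1), g (N + k - j) k := by
  rw [Finset.sum_coe_sort ((Finset.range N ×ˢ Finset.range N).filter
    (fun p => 1 ≤ p.2 ∧ p.2 ≤ p.1)) (fun p => g p.1 p.2), Finset.sum_sigma']
  refine Finset.sum_bij' (fun p _ => (⟨N + p.2 - p.1, p.2⟩ : (_ : ℕ) × ℕ))
    (fun p _ => (N + p.2 - p.1, p.2)) ?_ ?_ ?_ ?_ ?_
  · simp; omega
  · simp; omega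
  · simp; omega
  · rintro ⟨a, b⟩ h
    simp at h ⊢
    omega
  · rintro ⟨a, b⟩ h
    simp at h ⊢
    rw [show N + b - (N + b - a) = a by omega]

/-- Groups by $k-i+1$, the index of the parameter $\xi_L$ attached to $T_{k+1,i}-T_{k,i}$. -/
lemma sum_Idx_diagonals {M : Type*} [AddCommMonoid M] (N : ℕ) (g : ℕ → ℕ → M) :
    ∑ p : Idx N, g p.1.1 p.1.2 =
      ∑ i ∈ Finset.Icc 1 (N - 1), ∑ k ∈ Finset.Icc 1 (N - i), g (k + i - 1) k := by
  rw [Finset.sum_coe_sort ((Finset.range N ×ˢ Finset.range N).filter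
    (fun p => 1 ≤ p.2 ∧ p.2 ≤ p.1)) (fun p => g p.1 p.2), Finset.sum_sigma']
  refine Finset.sum_bij' (fun p _ => (⟨p.1 + 1 - p.2, p.2⟩ : (_ : ℕ) × ℕ))
    (fun p _ => (p.2 + p.1 - 1, p.2)) ?_ ?_ ?_ ?_ ?_
  · simp; omega
  · simp; omega
  · simp; omega
  · rintro ⟨a, b⟩ h
    simp at h ⊢
    omega
  · rintro ⟨a, b⟩ h
    simp at h ⊢
    rw [show b + (a + 1 - b) - 1 = a by omega]

lemma sum_mul_sub_pred (a S : ℕ → ℂ) (h0 : S 0 = 0) (n : ℕ) :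
    ∑ k ∈ Finset.Icc 1 (n + 1), a k * (S k - S (k - 1)) =
      ∑ k ∈ Finset.Icc 1 n, (a k - a (k + 1)) * S k + a (n + 1) * S (n + 1) := by
  induction n with
  | zero => simp [h0]
  | succ n ih =>
    rw [Finset.sum_Icc_succ_top (by omega), ih, Finset.sum_Icc_succ_top (by omega)]
    simp only [Nat.add_sub_cancel]
    ring

end Sums

/-! ### Coordinates and partial derivatives on the triangle. -/

section Derivatives

/-- The variable `T_{k,i}` (zero outside of the triangle) as a linear functional. -/
noncomputable def varL (N k i : ℕ) : Coord N →L[ℂ] ℂ :=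
  if h : (k, i) ∈ (Finset.range N ×ˢ Finset.range N).filter (fun p => 1 ≤ p.2 ∧ p.2 ≤ p.1) then
    ContinuousLinearMap.proj ⟨(k, i), h⟩
  else 0

lemma varL_apply (N k i : ℕ) (T : Coord N) : varL N k i T = var N T k i := by
  unfold varL var ext
  split_ifs <;> simp

/-- The basis vector of the direction `∂ / ∂T_{k,i}`, zero outside of the triangle. -/
noncomputable def dirVec (N k i : ℕ) : Coord N :=
  if h : (k, i) ∈ (Finset.range N ×ˢ Finset.range N).filter (fun p => 1 ≤ p.2 ∧ p.2 ≤ p.1) then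
    Pi.single (⟨(k, i), h⟩ : Idx N) 1
  else 0

lemma pd_eq (N k i : ℕ) (f : Coord N → ℂ) (T : Coord N) :
    pd N k i f T = fderiv ℂ f T (dirVec N k i) := by
  unfold pd dirVec
  split_ifs <;> simp

lemma dirVec_of_not {N k i : ℕ} (h : ¬ (1 ≤ i ∧ i ≤ k ∧ k < N)) : dirVec N k i = 0 := by
  unfold dirVec
  rw [dif_neg]
  simp
  omega

lemma varL_dirVec {N k i : ℕ} (h : 1 ≤ i ∧ i ≤ k ∧ k < N) (a b : ℕ) :
    varL N a b (dirVec N k i) = if a = k ∧ b = i then 1 else 0 := by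
  have hm : (k, i) ∈ (Finset.range N ×ˢ Finset.range N).filter
      (fun p => 1 ≤ p.2 ∧ p.2 ≤ p.1) := by
    simp; omega
  unfold varL dirVec
  rw [dif_pos hm]
  by_cases hab : a = k ∧ b = i
  · obtain ⟨rfl, rfl⟩ := hab
    rw [dif_pos hm]
    simp
  · rw [if_neg hab]
    split_ifs with h'
    · have hne : (⟨(a, b), h'⟩ : Idx N) ≠ ⟨(k, i), hm⟩ := by
        intro h0
        have := congrArg Subtype.val h0
        simp only [Prod.mk.injEq] at this
        exact hab this
      simp [hne]
    · simp

lemma var_top (N : ℕ) (T : Coord N) (i : ℕ) : var N T N i = 0 := by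
  unfold var ext
  rw [dif_neg (by simp)]
  simp

lemma hasFDerivAt_exp_var_sub (N a b c d : ℕ) (T : Coord N) :
    HasFDerivAt (fun T => Complex.exp (var N T a b - var N T c d))
      (Complex.exp (var N T a b - var N T c d) • (varL N a b - varL N c d)) T := by
  simp only [← varL_apply]
  exact ((varL N a b - varL N c d).hasFDerivAt (x := T)).cexp

/-- Extension by zero of a character to the index `0`. -/
def zeroExt (ξ : ℕ → ℂ) (j : ℕ) : ℂ := if j = 0 then 0 else ξ j

end Derivatives

/-! ### The right Whittaker vector. -/

section RightWhittaker

variable {N : ℕ}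

/-- A variable $T_{k,i}$ occurs in at most two exponentials, the diagonal edges leaving and entering
it. `zeroExt` removes the entering edge when `i = 1`, and lets `i = 0` stand for the omitted
derivative. -/
lemma pd_psiR (xiR : ℕ → ℂ) (T : Coord N) {k i : ℕ} (hik : i ≤ k) (hk : k < N) :
    pd N k i (psiR N xiR) T = psiR N xiR T *
      (zeroExt xiR i * Complex.exp (var N T k i - var N T (k + 1) (i + 1)) -
        zeroExt xiR (i - 1) * Complex.exp (var N T (k - 1) (i - 1) - var N T k i)) := by
  rw [pd_eq]
  rcases Nat.eq_zero_or_pos i with rfl | hi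
  · rw [dirVec_of_not (by omega)]
    simp [zeroExt]
  have hd : HasFDerivAt (psiR N xiR) _ T :=
    (HasFDerivAt.fun_sum (u := Finset.Icc 1 (N - 1)) fun i _ =>
      (HasFDerivAt.fun_sum (u := Finset.Icc i (N - 1)) fun k _ =>
        hasFDerivAt_exp_var_sub N k i (k + 1) (i + 1) T).const_mul (xiR i)).cexp
  rw [hd.fderiv]
  simp only [smul_apply, _root_.sum_apply, sub_apply, varL_dirVec ⟨hi, hik, hk⟩,
    smul_eq_mul]
  change psiR N xiR T * _ = _
  congr 1
  have e1 : ∑ j ∈ Finset.Icc 1 (N - 1), xiR j * ∑ s ∈ Finset.Icc j (N - 1),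
      Complex.exp (var N T s j - var N T (s + 1) (j + 1)) *
        (if s = k ∧ j = i then (1 : ℂ) else 0) =
      zeroExt xiR i * Complex.exp (var N T k i - var N T (k + 1) (i + 1)) := by
    rw [Finset.sum_eq_single i, Finset.sum_eq_single k]
    · simp [zeroExt, hi.ne']
    · intro s _ hs; simp [hs]
    · intro hs; simp at hs; omega
    · intro j _ hj; simp [hj]
    · intro hj; simp at hj; omega
  have e2 : ∑ j ∈ Finset.Icc 1 (N - 1), xiR j * ∑ s ∈ Finset.Icc j (N - 1),
      Complex.exp (var N T s j - var N T (s + 1) (j + 1)) *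
        (if s + 1 = k ∧ j + 1 = i then (1 : ℂ) else 0) =
      zeroExt xiR (i - 1) * Complex.exp (var N T (k - 1) (i - 1) - var N T k i) := by
    rcases eq_or_ne i 1 with rfl | hi1
    · rw [Finset.sum_eq_zero]
      · simp [zeroExt]
      · intro j hj
        rw [Finset.sum_eq_zero, mul_zero]
        intro s _
        rw [if_neg, mul_zero]
        simp at hj; omega
    · rw [Finset.sum_eq_single (i - 1), Finset.sum_eq_single (k - 1)]
      · rw [if_pos (by omega), show k - 1 + 1 = k by omega, show i - 1 + 1 = i by omega]
        simp [zeroExt, show i - 1 ≠ 0 by omega]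
      · intro s _ hs; rw [if_neg (by omega), mul_zero]
      · intro hs; simp at hs; omega
      · intro j _ hj
        rw [Finset.sum_eq_zero, mul_zero]
        intro s _
        rw [if_neg (by omega), mul_zero]
      · intro hj; simp at hj; omega
  rw [← e1, ← e2, ← Finset.sum_sub_distrib]
  refine Finset.sum_congr rfl fun j _ => ?_
  rw [← mul_sub, ← Finset.sum_sub_distrib]
  simp only [mul_sub]

theorem isRightWhittaker_psiR (N : ℕ) (xiR : ℕ → ℂ) :
    IsRightWhittaker N xiR (psiR N xiR) := by
  intro i hi T
  rw [Finset.mem_Icc] at hi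
  obtain ⟨c, hN⟩ : ∃ c, N = c + i + 1 := ⟨N - i - 1, by omega⟩
  -- Terms linking rows `c + n` and `c + n + 1`. The difference of two derivatives in row `c + n`
  -- regroups as `h n - h (n - 1)`.
  set h : ℕ → ℂ := fun n =>
    zeroExt xiR n * Complex.exp (var N T (c + n) n - var N T (c + n + 1) (n + 1)) -
    zeroExt xiR (n - 1) * Complex.exp (var N T (c + n) (n - 1) - var N T (c + n + 1) n) with hh
  set b : ℕ → ℂ := fun k => Complex.exp (var N T (c + k + 1) k - var N T (c + k) k) with hb
  set g : ℕ → ℂ := fun k =>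
    zeroExt xiR k * Complex.exp (var N T (c + k + 1) k - var N T (c + k + 1) (k + 1)) with hg
  have hpd : ∀ n ∈ Finset.Icc 1 i,
      pd N (N + n - i - 1) n (psiR N xiR) T - pd N (N + n - i - 1) (n - 1) (psiR N xiR) T =
        psiR N xiR T * (h n - h (n - 1)) := by
    intro n hn
    rw [Finset.mem_Icc] at hn
    rw [show N + n - i - 1 = c + n by omega, pd_psiR xiR T (by omega) (by omega),
      pd_psiR xiR T (by omega) (by omega), ← mul_sub]
    simp only [hh]
    rw [show c + (n - 1) = c + n - 1 by omega, show c + n - 1 + 1 = c + n by omega,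
      show n - 1 + 1 = n by omega]
    ring
  have hbk : ∀ k, Complex.exp (var N T (N + k - i) k - var N T (N + k - i - 1) k) = b k := by
    intro k
    rw [show N + k - i - 1 = c + k by omega, show N + k - i = c + k + 1 by omega]
  have hE : Eup N i (psiR N xiR) T =
      ∑ n ∈ Finset.Icc 1 i, ∑ k ∈ Finset.Icc n i,
        psiR N xiR T * (b k * (h n - h (n - 1))) := by
    unfold Eup
    refine Finset.sum_congr rfl fun n hn => ?_
    rw [hpd n hn, Finset.sum_mul]
    refine Finset.sum_congr rfl fun k _ => ?_
    rw [hbk]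
    ring
  -- A vertical edge times a diagonal edge is a difference inside a single row, so the outer sum
  -- telescopes as well.
  have hbh : ∀ k ∈ Finset.Icc 1 i, b k * h k = g k - g (k - 1) := by
    intro k hk
    rw [Finset.mem_Icc] at hk
    simp only [hb, hh, hg]
    rw [show c + (k - 1) + 1 = c + k by omega, show k - 1 + 1 = k by omega, mul_sub,
      mul_left_comm, mul_left_comm _ (zeroExt xiR (k - 1)), ← Complex.exp_add, ← Complex.exp_add]
    congr 3 <;> ring
  rw [hE, Finset.sum_comm' (t' := Finset.Icc 1 i) (s' := fun k => Finset.Icc 1 k)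
    (by intro x y; simp; omega)]
  have h1 : ∀ k ∈ Finset.Icc 1 i,
      ∑ n ∈ Finset.Icc 1 k, psiR N xiR T * (b k * (h n - h (n - 1))) =
        psiR N xiR T * (g k - g (k - 1)) := by
    intro k hk
    rw [← Finset.mul_sum, ← Finset.mul_sum, sum_Icc_one_sub_pred, ← hbh k hk]
    simp [hh, zeroExt]
  rw [Finset.sum_congr rfl h1, ← Finset.mul_sum, sum_Icc_one_sub_pred, mul_comm]
  congr 1
  simp only [hg]
  -- The surviving term `g i` lies in row `N`, where the variables vanish; only the character is
  -- left.
  rw [← hN, var_top, var_top]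
  simp [zeroExt, show i ≠ 0 by omega]

end RightWhittaker

/-! ### The left Whittaker vector. -/

section LeftWhittaker

variable {N : ℕ}

lemma hasFDerivAt_var (N k i : ℕ) (T : Coord N) :
    HasFDerivAt (fun T => var N T k i) (varL N k i) T := by
  simp only [← varL_apply]
  exact (varL N k i).hasFDerivAt

lemma pd_psiL (m xiL : ℕ → ℂ) (T : Coord N) {k i : ℕ} (hi : 1 ≤ i) (hik : i ≤ k) (hk : k < N) :
    pd N k i (psiL N m xiL) T = psiL N m xiL T * (m k - m (k + 1) +
      (zeroExt xiL (k - i) * Complex.exp (var N T k i - var N T (k - 1) i) -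
        zeroExt xiL (k + 1 - i) * Complex.exp (var N T (k + 1) i - var N T k i))) := by
  rw [pd_eq]
  have hd : HasFDerivAt (psiL N m xiL) _ T :=
    ((HasFDerivAt.fun_sum (u := Finset.Icc 1 (N - 1)) fun k _ =>
      (HasFDerivAt.fun_sum (u := Finset.Icc 1 k) fun i _ =>
        (hasFDerivAt_var N k i T).const_mul (m k - m (k + 1)))).add
    (HasFDerivAt.fun_sum (u := Finset.Icc 1 (N - 1)) fun i _ =>
      (HasFDerivAt.fun_sum (u := Finset.Icc 1 (N - i)) fun k _ =>
        hasFDerivAt_exp_var_sub N (k + i) k (k + i - 1) k T).const_mul (xiL i))).cexp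
  rw [hd.fderiv]
  simp only [smul_apply, add_apply, _root_.sum_apply, sub_apply, varL_dirVec ⟨hi, hik, hk⟩,
    smul_eq_mul]
  change psiL N m xiL T * _ = _
  congr 1
  congr 1
  · rw [Finset.sum_eq_single k, Finset.sum_eq_single i]
    · simp
    · intro s _ hs; simp [hs]
    · intro hs; simp at hs; omega
    · intro j _ hj; simp [hj]
    · intro hj; simp at hj; omega
  have e1 : ∑ j ∈ Finset.Icc 1 (N - 1), xiL j * ∑ s ∈ Finset.Icc 1 (N - j),
      Complex.exp (var N T (s + j) s - var N T (s + j - 1) s) *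
        (if s + j = k ∧ s = i then (1 : ℂ) else 0) =
      zeroExt xiL (k - i) * Complex.exp (var N T k i - var N T (k - 1) i) := by
    rcases eq_or_ne k i with rfl | hki
    · rw [Finset.sum_eq_zero]
      · simp [zeroExt]
      · intro j hj
        rw [Finset.sum_eq_zero, mul_zero]
        intro s _
        rw [if_neg, mul_zero]
        simp at hj; omega
    · rw [Finset.sum_eq_single (k - i), Finset.sum_eq_single i]
      · rw [if_pos (by omega), show i + (k - i) = k by omega]
        simp [zeroExt, show k - i ≠ 0 by omega]
      · intro s _ hs; rw [if_neg (by omega), mul_zero]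
      · intro hs; simp at hs; omega
      · intro j _ hj
        rw [Finset.sum_eq_zero, mul_zero]
        intro s _
        rw [if_neg (by omega), mul_zero]
      · intro hj; simp at hj; omega
  have e2 : ∑ j ∈ Finset.Icc 1 (N - 1), xiL j * ∑ s ∈ Finset.Icc 1 (N - j),
      Complex.exp (var N T (s + j) s - var N T (s + j - 1) s) *
        (if s + j - 1 = k ∧ s = i then (1 : ℂ) else 0) =
      zeroExt xiL (k + 1 - i) * Complex.exp (var N T (k + 1) i - var N T k i) := by
    rw [Finset.sum_eq_single (k + 1 - i), Finset.sum_eq_single i]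
    · rw [if_pos (by omega), show i + (k + 1 - i) = k + 1 by omega]
      simp [zeroExt, show k + 1 - i ≠ 0 by omega]
    · intro s _ hs; rw [if_neg (by omega), mul_zero]
    · intro hs; simp at hs; omega
    · intro j hj' hj
      rw [Finset.sum_eq_zero, mul_zero]
      intro s hs
      simp at hj' hs
      rw [if_neg (by omega), mul_zero]
    · intro hj; simp at hj; omega
  rw [← e1, ← e2, ← Finset.sum_sub_distrib]
  refine Finset.sum_congr rfl fun j _ => ?_
  rw [← mul_sub, ← Finset.sum_sub_distrib]
  simp only [mul_sub]

/-- At `s = i` the derivative in column `i + 1` is omitted and the one in column `i` cancels `m i -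
m (i + 1)`; for larger `s` the constants of the two columns cancel. The vertical edges telescope
along each column. -/
lemma sum_pd_psiL (m xiL : ℕ → ℂ) (T : Coord N) {k i : ℕ} (hi : 1 ≤ i) (hik : i ≤ k) :
    k < N → (m i - m (i + 1)) * psiL N m xiL T +
      ∑ s ∈ Finset.Icc i k,
        (pd N s (i + 1) (psiL N m xiL) T - pd N s i (psiL N m xiL) T) =
      psiL N m xiL T *
        (zeroExt xiL (k + 1 - i) * Complex.exp (var N T (k + 1) i - var N T k i) -
          zeroExt xiL (k - i) * Complex.exp (var N T (k + 1) (i + 1) - var N T k (i + 1))) := by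
  induction k, hik using Nat.le_induction with
  | base =>
    intro hk
    rw [Finset.Icc_self, Finset.sum_singleton, pd_psiL m xiL T hi le_rfl hk, pd_eq,
      dirVec_of_not (by omega), map_zero]
    simp [zeroExt]
    ring
  | succ k hk ih =>
    intro hk'
    rw [Finset.sum_Icc_succ_top (by omega), ← add_assoc, ih (by omega),
      pd_psiL m xiL T hi (by omega) hk', pd_psiL m xiL T (by omega) (by omega) hk']
    simp only [Nat.add_sub_cancel, Nat.add_sub_add_right]
    ring

theorem isLeftWhittaker_psiL (N : ℕ) (m xiL : ℕ → ℂ) :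
    IsLeftWhittaker N m xiL (psiL N m xiL) := by
  intro i hi T
  rw [Finset.mem_Icc] at hi
  -- Multiplication by the diagonal exponential again yields differences inside one row. `G i`
  -- vanishes because `zeroExt` is zero at `0`, and `G N` gives the character at `N - i`.
  set G : ℕ → ℂ := fun k =>
    zeroExt xiL (k - i) * Complex.exp (var N T k i - var N T k (i + 1)) with hG
  have h : ∀ k ∈ Finset.Icc i (N - 1),
      Complex.exp (var N T k i - var N T (k + 1) (i + 1)) *
        ((m i - m (i + 1)) * psiL N m xiL T + ∑ s ∈ Finset.Icc i k,
          (pd N s (i + 1) (psiL N m xiL) T - pd N s i (psiL N m xiL) T)) =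
      psiL N m xiL T * (G (k + 1) - G k) := by
    intro k hk
    rw [Finset.mem_Icc] at hk
    rw [sum_pd_psiL m xiL T hi.1 hk.1 (by omega), mul_left_comm]
    congr 1
    simp only [hG]
    rw [mul_sub, mul_left_comm, mul_left_comm _ (zeroExt xiL (k - i)), ← Complex.exp_add,
      ← Complex.exp_add]
    congr 3 <;> ring
  unfold Elow
  rw [Finset.sum_congr rfl h, ← Finset.mul_sum, sum_Icc_succ_sub G hi.2, mul_comm]
  congr 1
  simp only [hG]
  rw [show N - 1 + 1 = N by omega, var_top, var_top]
  simp [zeroExt, show N - i ≠ 0 by omega]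

end LeftWhittaker

/-! ### The integrated Cartan action. -/

section Cartan

theorem integratesCartan_cartan (N : ℕ) (m : ℕ → ℂ) : IntegratesCartan N m (cartan N m) := by
  intro f hf x T
  refine ⟨by simp [cartan], fun s => ?_⟩
  set v : Coord N := fun p => (x p.1.2 : ℂ) - (x (N + p.1.2 - p.1.1) : ℂ) with hv
  set c : ℂ := ∑ i ∈ Finset.Icc 1 N, m i * (x i : ℂ) with hc
  have hcartan : ∀ (t : ℝ) (S : Coord N), cartan N m (t • x) f S =
      Complex.exp (-((t : ℂ) * c)) * f (S + (t : ℂ) • v) := by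
    intro t S
    unfold cartan
    congr 2
    · simp only [hc, Finset.mul_sum, Pi.smul_apply, smul_eq_mul, Complex.ofReal_mul]
      congr 1
      exact Finset.sum_congr rfl fun i _ => by ring
    · ext p
      simp [hv]
      ring
  have hfd : ∀ S : Coord N, HasFDerivAt (cartan N m (s • x) f)
      (Complex.exp (-((s : ℂ) * c)) • fderiv ℂ f (S + (s : ℂ) • v)) S := by
    intro S
    rw [show cartan N m (s • x) f = fun S =>
      Complex.exp (-((s : ℂ) * c)) * f (S + (s : ℂ) • v) from funext (hcartan s)]
    have h := (hf (S + (s : ℂ) • v)).hasFDerivAt.comp S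
      ((hasFDerivAt_id S).add_const ((s : ℂ) • v))
    rw [ContinuousLinearMap.comp_id] at h
    exact h.const_mul _
  set D : Coord N →L[ℂ] ℂ := fderiv ℂ (cartan N m (s • x) f) T with hD
  -- Collect the coefficient of each `x i` in the translation: it appears positively along column
  -- `i` and negatively on the line $N+i'-k=i$, which are the two derivative sums of the Cartan
  -- generator with opposite sign.
  have hDv : D v = ∑ i ∈ Finset.Icc 1 N, (x i : ℂ) *
      (∑ k ∈ Finset.Icc i (N - 1), D (dirVec N k i) -
        ∑ k ∈ Finset.Icc 1 (i - 1), D (dirVec N (N + k - i) k)) := by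
    have h1 : ∀ p : Idx N, (Pi.single p 1 : Coord N) = dirVec N p.1.1 p.1.2 := by
      intro p
      unfold dirVec
      rw [dif_pos p.2]
    have h2 : v = ∑ p : Idx N, v p • (Pi.single p 1 : Coord N) := by
      ext q
      simp [Finset.sum_apply, Pi.single_apply]
    have h3 : D v = ∑ p : Idx N, (x p.1.2 : ℂ) * D (dirVec N p.1.1 p.1.2) -
        ∑ p : Idx N, (x (N + p.1.2 - p.1.1) : ℂ) * D (dirVec N p.1.1 p.1.2) := by
      rw [← Finset.sum_sub_distrib]
      conv_lhs => rw [h2, map_sum]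
      refine Finset.sum_congr rfl fun p _ => ?_
      rw [map_smul, h1, smul_eq_mul, ← sub_mul]
    rw [h3, sum_Idx_columns N fun k i => (x i : ℂ) * D (dirVec N k i),
      sum_Idx_antidiagonals N fun k i => (x (N + i - k) : ℂ) * D (dirVec N k i),
      ← Finset.sum_sub_distrib]
    refine Finset.sum_congr rfl fun i hi => ?_
    rw [mul_sub, Finset.mul_sum, Finset.mul_sum]
    congr 1
    refine Finset.sum_congr rfl fun k hk => ?_
    simp only [Finset.mem_Icc] at hi hk
    rw [show N + k - (N + k - i) = i by omega]
  have hsum : -∑ i ∈ Finset.Icc 1 N, (x i : ℂ) * Ediag N m i (cartan N m (s • x) f) T =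
      -c * cartan N m (s • x) f T + D v := by
    rw [hDv, hc, neg_mul, Finset.sum_mul, ← Finset.sum_neg_distrib, ← Finset.sum_neg_distrib,
      ← Finset.sum_add_distrib]
    refine Finset.sum_congr rfl fun i _ => ?_
    simp only [Ediag, pd_eq]
    ring
  have hline : HasDerivAt (fun t : ℝ => T + (t : ℂ) • v) v s := by
    have := (Complex.ofRealCLM.hasDerivAt (x := s)).smul_const v
    simpa using this.const_add T
  have h1 : HasDerivAt (fun t : ℝ => f (T + (t : ℂ) • v)) (fderiv ℂ f (T + (s : ℂ) • v) v) s :=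
    ((hf _).hasFDerivAt.restrictScalars ℝ).comp_hasDerivAt s hline
  have h2 : HasDerivAt (fun t : ℝ => Complex.exp (-((t : ℂ) * c)))
      (Complex.exp (-((s : ℂ) * c)) * -c) s := by
    have := ((Complex.ofRealCLM.hasDerivAt (x := s)).mul_const c).neg.cexp
    simpa using this
  rw [hsum, hD, (hfd T).fderiv, hcartan]
  simp only [hcartan]
  refine (h2.fun_mul h1).congr_deriv ?_
  rw [smul_apply, smul_eq_mul]
  ring

end Cartan

/-! ### Matching the two integrands by a translation. -/

section IntegralRepresentation

variable {N : ℕ}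

/-- The translation of the variables `T_{k,i}` by `x_i`. -/
def colShift (N : ℕ) (x : ℕ → ℝ) : Coord N := fun p => (x p.1.2 : ℂ)

/-- The formula includes the bottom row, where the convention $T_{N,i}=0$ turns into $T_{N,i}=x_i$,
so that row needs no separate treatment below. -/
lemma ext_add_colShift (x : ℕ → ℝ) (T : Coord N) {k i : ℕ} (hi : 1 ≤ i) (hik : i ≤ k)
    (hk : k ≤ N) : ext N x (T + colShift N x) k i = var N T k i + x i := by
  unfold var ext
  rcases hk.lt_or_eq with hk | rfl
  · have hm : (k, i) ∈ (Finset.range N ×ˢ Finset.range N).filter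
        (fun p => 1 ≤ p.2 ∧ p.2 ≤ p.1) := by
      simp; omega
    rw [dif_pos hm, dif_pos hm]
    simp [colShift]
  · rw [dif_neg (by simp), dif_neg (by simp)]
    simp

/-- At `k = N` the two shifts cancel, in agreement with $T_{N,i}=0$. -/
lemma var_cartan_shift (x : ℕ → ℝ) (T : Coord N) {k i : ℕ} (hi : 1 ≤ i) (hik : i ≤ k)
    (hk : k ≤ N) :
    var N (fun p => T p + (x p.1.2 : ℂ) - (x (N + p.1.2 - p.1.1) : ℂ)) k i =
      var N T k i + x i - x (N + i - k) := by
  unfold var ext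
  rcases hk.lt_or_eq with hk | rfl
  · have hm : (k, i) ∈ (Finset.range N ×ˢ Finset.range N).filter
        (fun p => 1 ≤ p.2 ∧ p.2 ≤ p.1) := by
      simp; omega
    rw [dif_pos hm, dif_pos hm]
  · rw [dif_neg (by simp), dif_neg (by simp)]
    simp

lemma conj_var_conj (T : Coord N) (k i : ℕ) :
    (starRingEnd ℂ) (var N (fun p => (starRingEnd ℂ) (T p)) k i) = var N T k i := by
  unfold var ext
  split_ifs <;> simp

/-- The `-1` is $-(\rho_k-\rho_{k+1})$; it will cancel the density $\prod e^{T_{k,i}}$. -/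
lemma conj_mu_sub_mu_succ (hbar : ℝ) (lam : ℕ → ℝ) (k : ℕ) :
    (starRingEnd ℂ) (mu N hbar lam k - mu N hbar lam (k + 1)) =
      1 / (hbar : ℂ) * (Complex.I * ((lam k : ℂ) - lam (k + 1))) - 1 := by
  simp only [mu, rho, map_sub, map_mul, map_neg, Complex.conj_I, Complex.conj_ofReal]
  push_cast
  ring

lemma bar_psiL (hbar : ℝ) (lam : ℕ → ℝ) (xiL : ℕ → ℂ) (T : Coord N) :
    bar (psiL N (mu N hbar lam) xiL) T = Complex.exp
      (∑ k ∈ Finset.Icc 1 (N - 1), ∑ i ∈ Finset.Icc 1 k,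
          (1 / (hbar : ℂ) * (Complex.I * ((lam k : ℂ) - lam (k + 1))) - 1) * var N T k i +
        ∑ i ∈ Finset.Icc 1 (N - 1), (starRingEnd ℂ) (xiL i) *
          ∑ k ∈ Finset.Icc 1 (N - i),
            Complex.exp (var N T (k + i) k - var N T (k + i - 1) k)) := by
  simp only [bar, psiL, ← Complex.exp_conj, map_add, map_sum, map_mul, conj_mu_sub_mu_succ]
  simp only [map_sub, conj_var_conj]

lemma linearTerm_add_colShift (hN : 1 ≤ N) (lam x : ℕ → ℝ) (T : Coord N) :
    linearTerm N lam x (T + colShift N x) = Complex.I *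
      (∑ k ∈ Finset.Icc 1 (N - 1), ((lam k : ℂ) - lam (k + 1)) * ∑ i ∈ Finset.Icc 1 k, var N T k i +
        ∑ k ∈ Finset.Icc 1 N, (lam k : ℂ) * x k) := by
  unfold linearTerm
  congr 1
  have h1 : ∀ k ∈ Finset.Icc 1 N, (lam k : ℂ) *
      (∑ i ∈ Finset.Icc 1 k, ext N x (T + colShift N x) k i -
        ∑ i ∈ Finset.Icc 1 (k - 1), ext N x (T + colShift N x) (k - 1) i) =
      (lam k : ℂ) * (∑ i ∈ Finset.Icc 1 k, var N T k i -
        ∑ i ∈ Finset.Icc 1 (k - 1), var N T (k - 1) i) + (lam k : ℂ) * x k := by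
    intro k hk
    rw [Finset.mem_Icc] at hk
    obtain ⟨k, rfl⟩ : ∃ j, k = j + 1 := ⟨k - 1, by omega⟩
    rw [Nat.add_sub_cancel]
    have h2 : ∀ l, l ≤ k + 1 → ∑ i ∈ Finset.Icc 1 l, ext N x (T + colShift N x) l i =
        ∑ i ∈ Finset.Icc 1 l, var N T l i + ∑ i ∈ Finset.Icc 1 l, (x i : ℂ) := by
      intro l hl
      rw [← Finset.sum_add_distrib]
      refine Finset.sum_congr rfl fun i hi => ?_
      rw [Finset.mem_Icc] at hi
      exact ext_add_colShift x T hi.1 hi.2 (by omega)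
    rw [h2 _ le_rfl, h2 k (by omega), Finset.sum_Icc_succ_top (b := k) (by omega) fun i => (x i : ℂ)]
    ring
  rw [Finset.sum_congr rfl h1, Finset.sum_add_distrib]
  congr 1
  obtain ⟨n, rfl⟩ : ∃ n, N = n + 1 := ⟨N - 1, by omega⟩
  rw [sum_mul_sub_pred (fun k => (lam k : ℂ))
    (fun k => ∑ i ∈ Finset.Icc 1 k, var (n + 1) T k i) (by simp) n]
  simp [var_top]

/-- After the translation `T_{k,i} ↦ T_{k,i} + x_i` the integrand of the integral representation
becomes the integrand of the matrix element. -/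
theorem giventalIntegrand_add_colShift (hN : 1 ≤ N) (hbar : ℝ) (lam : ℕ → ℝ) (xiL xiR : ℕ → ℂ)
    (x : ℕ → ℝ) (T : Coord N) :
    giventalIntegrand N hbar lam xiL xiR x (T + colShift N x) =
      Complex.exp (-∑ i ∈ Finset.Icc 1 N, (x i : ℂ) * (rho N i : ℂ)) *
        matrixElementIntegrand N hbar lam xiL xiR x T := by
  -- The left exponents are differences within one column, hence unaffected by a shift depending on
  -- the column only.
  have hL : ∑ i ∈ Finset.Icc 1 (N - 1), (starRingEnd ℂ) (xiL i) * ∑ k ∈ Finset.Icc 1 (N - i),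
      Complex.exp (ext N x (T + colShift N x) (k + i) k -
        ext N x (T + colShift N x) (k + i - 1) k) =
      ∑ i ∈ Finset.Icc 1 (N - 1), (starRingEnd ℂ) (xiL i) * ∑ k ∈ Finset.Icc 1 (N - i),
        Complex.exp (var N T (k + i) k - var N T (k + i - 1) k) := by
    refine Finset.sum_congr rfl fun i hi => ?_
    congr 1
    refine Finset.sum_congr rfl fun k hk => ?_
    rw [Finset.mem_Icc] at hi hk
    rw [ext_add_colShift x T (by omega) (by omega) (by omega),
      ext_add_colShift x T (by omega) (by omega) (by omega)]
    congr 1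
    ring
  -- Along a diagonal edge $N+i-k$ is constant, so the Cartan translation also changes the
  -- difference by $x_i-x_{i+1}$.
  have hR : ∑ i ∈ Finset.Icc 1 (N - 1), xiR i * ∑ k ∈ Finset.Icc i (N - 1),
      Complex.exp (ext N x (T + colShift N x) k i -
        ext N x (T + colShift N x) (k + 1) (i + 1)) =
      ∑ i ∈ Finset.Icc 1 (N - 1), xiR i * ∑ k ∈ Finset.Icc i (N - 1), Complex.exp
        (var N (fun p => T p + (x p.1.2 : ℂ) - (x (N + p.1.2 - p.1.1) : ℂ)) k i -
        var N (fun p => T p + (x p.1.2 : ℂ) - (x (N + p.1.2 - p.1.1) : ℂ)) (k + 1) (i + 1)) := by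
    refine Finset.sum_congr rfl fun i hi => ?_
    congr 1
    refine Finset.sum_congr rfl fun k hk => ?_
    rw [Finset.mem_Icc] at hi hk
    rw [ext_add_colShift x T (by omega) (by omega) (by omega),
      ext_add_colShift x T (by omega) (by omega) (by omega),
      var_cartan_shift x T (by omega) (by omega) (by omega),
      var_cartan_shift x T (by omega) (by omega) (by omega),
      show N + (i + 1) - (k + 1) = N + i - k by omega]
    congr 1
    ring
  have hT : ∑ p, T p = ∑ k ∈ Finset.Icc 1 (N - 1), ∑ i ∈ Finset.Icc 1 k, var N T k i := by
    rw [← sum_Idx]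
    refine Finset.sum_congr rfl fun p _ => ?_
    unfold var ext
    rw [dif_pos p.2]
  have hmu : ∑ i ∈ Finset.Icc 1 N, mu N hbar lam i * (x i : ℂ) =
      -(1 / (hbar : ℂ) * (Complex.I * ∑ i ∈ Finset.Icc 1 N, (lam i : ℂ) * x i)) -
        ∑ i ∈ Finset.Icc 1 N, (x i : ℂ) * (rho N i : ℂ) := by
    simp only [Finset.mul_sum]
    rw [← Finset.sum_neg_distrib, ← Finset.sum_sub_distrib]
    refine Finset.sum_congr rfl fun i _ => ?_
    simp only [mu]
    push_cast
    ring
  have hlin : ∑ k ∈ Finset.Icc 1 (N - 1), ∑ i ∈ Finset.Icc 1 k,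
      (1 / (hbar : ℂ) * (Complex.I * ((lam k : ℂ) - lam (k + 1))) - 1) * var N T k i =
      1 / (hbar : ℂ) * (Complex.I * ∑ k ∈ Finset.Icc 1 (N - 1),
        ((lam k : ℂ) - lam (k + 1)) * ∑ i ∈ Finset.Icc 1 k, var N T k i) -
      ∑ k ∈ Finset.Icc 1 (N - 1), ∑ i ∈ Finset.Icc 1 k, var N T k i := by
    simp only [Finset.mul_sum]
    rw [← Finset.sum_sub_distrib]
    refine Finset.sum_congr rfl fun k _ => ?_
    rw [← Finset.sum_sub_distrib]
    refine Finset.sum_congr rfl fun i _ => ?_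
    ring
  simp only [giventalIntegrand, matrixElementIntegrand, pairingIntegrand, cartan, psiR, bar_psiL]
  rw [hL, hR, linearTerm_add_colShift hN, hT, hmu, hlin]
  simp only [← Complex.exp_add]
  congr 1
  ring

lemma contDiff_ext (x : ℕ → ℝ) (k i : ℕ) : ContDiff ℂ 1 fun T => ext N x T k i := by
  unfold ext
  split_ifs
  · exact contDiff_apply ℂ ℂ _
  · exact contDiff_const
  · exact contDiff_const

lemma contDiff_giventalIntegrand (hbar : ℝ) (lam : ℕ → ℝ) (xiL xiR : ℕ → ℂ) (x : ℕ → ℝ) :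
    ContDiff ℂ 1 (giventalIntegrand N hbar lam xiL xiR x) := by
  have h := fun k i => contDiff_ext (N := N) x k i
  unfold giventalIntegrand linearTerm
  fun_prop

end IntegralRepresentation

/-! ### The wave function on an admissible contour. -/

section WaveFunction

variable {N : ℕ}

lemma abs_le_sum_abs (x : ℕ → ℝ) {i : ℕ} (hi : i ∈ Finset.Icc 1 N) :
    |x i| ≤ ∑ j ∈ Finset.Icc 1 N, |x j| :=
  Finset.single_le_sum (f := fun j => |x j|) (fun _ _ => abs_nonneg _) hi

lemma matrixElementIntegrand_eq (hN : 1 ≤ N) (hbar : ℝ) (lam : ℕ → ℝ) (xiL xiR : ℕ → ℂ)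
    (x : ℕ → ℝ) (T : Coord N) :
    matrixElementIntegrand N hbar lam xiL xiR x T =
      Complex.exp (∑ i ∈ Finset.Icc 1 N, (x i : ℂ) * (rho N i : ℂ)) *
        giventalIntegrand N hbar lam xiL xiR x (T + colShift N x) := by
  rw [giventalIntegrand_add_colShift hN, ← mul_assoc, ← Complex.exp_add, add_neg_cancel,
    Complex.exp_zero, one_mul]

lemma contDiff_matrixElementIntegrand (hN : 1 ≤ N) (hbar : ℝ) (lam : ℕ → ℝ) (xiL xiR : ℕ → ℂ)
    (x : ℕ → ℝ) : ContDiff ℂ 1 (matrixElementIntegrand N hbar lam xiL xiR x) := by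
  have h := contDiff_giventalIntegrand (N := N) hbar lam xiL xiR x
  rw [show matrixElementIntegrand N hbar lam xiL xiR x = _ from
    funext (matrixElementIntegrand_eq hN hbar lam xiL xiR x)]
  fun_prop

lemma Contour.converges_of_le (G : Contour N) {F : Coord N → ℂ} (hF : Continuous F)
    (h : ∀ j, ∃ g : (Idx N → ℝ) → ℝ, Integrable g ∧
      ∀ u, ‖F (G.map j u)‖ * G.vol j u ≤ g u) : G.Converges F := by
  intro j
  obtain ⟨g, hg, hle⟩ := h j
  have hV : Continuous (G.vol j) := continuous_gramVol_jacobian (G.smooth j)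
  have hm := (G.smooth j).continuous
  refine hg.mono' (Continuous.aestronglyMeasurable (by fun_prop)) (Eventually.of_forall fun u => ?_)
  have hV0 : 0 ≤ G.vol j u := gramVol_nonneg _
  rw [Real.norm_of_nonneg (mul_nonneg (norm_nonneg _) hV0)]
  exact hle u

theorem Contour.Admissible.converges_matrixElementIntegrand (hN : 1 ≤ N) {hbar : ℝ}
    {lam : ℕ → ℝ} {xiL xiR : ℕ → ℂ} {G : Contour N} (hG : G.Admissible hbar lam xiL xiR)
    (x : ℕ → ℝ) : G.Converges (matrixElementIntegrand N hbar lam xiL xiR x) := by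
  refine G.converges_of_le (contDiff_matrixElementIntegrand hN hbar lam xiL xiR x).continuous
    fun j => ?_
  obtain ⟨g, hg, hle⟩ := hG x 0 j
  refine ⟨g, hg, fun u => ?_⟩
  simpa using hle 0 (by simp) u

/-- All translates by $-t\,x_i$ with $0\le t\le1$ have $|y_i|\le\sum_j|x_j|$, so one radius in the
definition of admissibility covers the whole segment. -/
lemma Contour.Admissible.exists_bound_segment {hbar : ℝ}
    {lam : ℕ → ℝ} {xiL xiR : ℕ → ℂ} {G : Contour N} (hG : G.Admissible hbar lam xiL xiR)
    (x : ℕ → ℝ) (j : Fin G.pieces) : ∃ g : (Idx N → ℝ) → ℝ, Integrable g ∧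
      ∀ t ∈ Set.Icc (0 : ℝ) 1, ∀ u,
        ‖matrixElementIntegrand N hbar lam xiL xiR x (G.map j u + t • -colShift N x)‖ *
          G.vol j u ≤ g u := by
  obtain ⟨g, hg, hle⟩ := hG x (∑ i ∈ Finset.Icc 1 N, |x i|) j
  refine ⟨g, hg, fun t ht u => ?_⟩
  have h := hle (fun i => -(t * x i)) (fun i hi => ?_) u
  · convert h using 4
    ext p
    simp [colShift]
  · rw [abs_neg, abs_mul, abs_of_nonneg ht.1]
    exact (mul_le_of_le_one_left (abs_nonneg _) ht.2).trans (abs_le_sum_abs x hi)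

lemma giventalIntegrand_eq (hN : 1 ≤ N) (hbar : ℝ) (lam : ℕ → ℝ) (xiL xiR : ℕ → ℂ)
    (x : ℕ → ℝ) (T : Coord N) :
    giventalIntegrand N hbar lam xiL xiR x T =
      Complex.exp (-∑ i ∈ Finset.Icc 1 N, (x i : ℂ) * (rho N i : ℂ)) *
        matrixElementIntegrand N hbar lam xiL xiR x (T + -colShift N x) := by
  rw [← giventalIntegrand_add_colShift hN, neg_add_cancel_right]

theorem Contour.Admissible.converges_giventalIntegrand (hN : 1 ≤ N) {hbar : ℝ}
    {lam : ℕ → ℝ} {xiL xiR : ℕ → ℂ} {G : Contour N} (hG : G.Admissible hbar lam xiL xiR)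
    (x : ℕ → ℝ) : G.Converges (giventalIntegrand N hbar lam xiL xiR x) := by
  refine G.converges_of_le (contDiff_giventalIntegrand hbar lam xiL xiR x).continuous
    fun j => ?_
  obtain ⟨g, hg, hle⟩ := hG.exists_bound_segment x j
  refine ⟨fun u => ‖Complex.exp (-∑ i ∈ Finset.Icc 1 N, (x i : ℂ) * (rho N i : ℂ))‖ * g u,
    hg.const_mul _, fun u => ?_⟩
  rw [giventalIntegrand_eq hN, norm_mul, mul_assoc]
  refine mul_le_mul_of_nonneg_left ?_ (norm_nonneg _)
  simpa using hle 1 (by simp) u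

theorem waveFunction_eq_integral (hN : 1 ≤ N) {hbar : ℝ}
    {lam : ℕ → ℝ} {xiL xiR : ℕ → ℂ} {G : Contour N} (hG : G.Admissible hbar lam xiL xiR)
    (x : ℕ → ℝ) :
    waveFunction N hbar lam xiL xiR G x =
      G.integral (giventalIntegrand N hbar lam xiL xiR x) := by
  change _ * G.integral (matrixElementIntegrand N hbar lam xiL xiR x) = _
  unfold Contour.integral
  rw [Finset.mul_sum]
  refine Finset.sum_congr rfl fun j _ => ?_
  rw [mul_left_comm]
  congr 1
  obtain ⟨g, hg, hle⟩ := hG.exists_bound_segment x j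
  have h := integral_comp_add_mul_det_jacobian (G.smooth j) (G.proper j)
    (contDiff_matrixElementIntegrand hN hbar lam xiL xiR x) (-colShift N x) hg hle
  simp only [giventalIntegrand_eq hN, mul_assoc]
  rw [integral_const_mul]
  exact congrArg _ h.symm

end WaveFunction

/-! ### Givental's potential and the real contour. -/

section RealContour

variable {N : ℕ}

lemma realContour_jac (j : Fin (realContour N).pieces) (u : Idx N → ℝ) :
    (realContour N).jac j u = 1 := by
  let L : (Idx N → ℝ) →L[ℝ] Coord N := ContinuousLinearMap.pi fun p : Idx N =>
    Complex.ofRealCLM.comp (ContinuousLinearMap.proj p)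
  have h : HasFDerivAt ((realContour N).map j) L u := L.hasFDerivAt
  ext p q
  simp only [Contour.jac, Matrix.of_apply, h.fderiv]
  by_cases hpq : p = q <;> simp [L, Matrix.one_apply, hpq]

lemma realContour_vol (j : Fin (realContour N).pieces) (u : Idx N → ℝ) :
    (realContour N).vol j u = 1 := by
  have : ((1 : Matrix (Idx N) (Idx N) ℂ).map Complex.re) = 1 :=
    Matrix.map_one _ Complex.zero_re Complex.one_re
  simp [Contour.vol, realContour_jac, this]

lemma realContour_integral (F : Coord N → ℂ) :
    (realContour N).integral F = ∫ u : Idx N → ℝ, F fun p => (u p : ℂ) := by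
  unfold Contour.integral
  simp only [realContour_jac, Matrix.det_one, mul_one]
  change ∑ j : Fin 1, _ = _
  simp [realContour]

/-- In the symmetric case the integrand is the exponential of Givental's potential. -/
lemma giventalIntegrand_eq_exp_potential {hbar : ℝ} {lam : ℕ → ℝ} {xiL xiR : ℕ → ℂ}
    (h : ∀ i ∈ Finset.Icc 1 (N - 1), xiL i = -(1 / (hbar : ℂ)) ∧ xiR i = -(1 / (hbar : ℂ)))
    (x : ℕ → ℝ) (T : Coord N) :
    giventalIntegrand N hbar lam xiL xiR x T =
      Complex.exp (1 / (hbar : ℂ) * potential N lam x T) := by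
  have hL : ∑ i ∈ Finset.Icc 1 (N - 1), (starRingEnd ℂ) (xiL i) * ∑ k ∈ Finset.Icc 1 (N - i),
      Complex.exp (ext N x T (k + i) k - ext N x T (k + i - 1) k) =
      -(1 / (hbar : ℂ)) * ∑ k ∈ Finset.Icc 1 (N - 1), ∑ i ∈ Finset.Icc 1 k,
        Complex.exp (ext N x T (k + 1) i - ext N x T k i) := by
    rw [← sum_Idx N fun k i => Complex.exp (ext N x T (k + 1) i - ext N x T k i),
      sum_Idx_diagonals N fun k i => Complex.exp (ext N x T (k + 1) i - ext N x T k i),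
      Finset.mul_sum]
    refine Finset.sum_congr rfl fun i hi => ?_
    rw [(h i hi).1]
    congr 1
    · simp
    · refine Finset.sum_congr rfl fun k hk => ?_
      rw [Finset.mem_Icc] at hi
      rw [show k + i - 1 + 1 = k + i by omega]
  have hR : ∑ i ∈ Finset.Icc 1 (N - 1), xiR i * ∑ k ∈ Finset.Icc i (N - 1),
      Complex.exp (ext N x T k i - ext N x T (k + 1) (i + 1)) =
      -(1 / (hbar : ℂ)) * ∑ k ∈ Finset.Icc 1 (N - 1), ∑ i ∈ Finset.Icc 1 k,
        Complex.exp (ext N x T k i - ext N x T (k + 1) (i + 1)) := by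
    rw [← sum_Idx N fun k i => Complex.exp (ext N x T k i - ext N x T (k + 1) (i + 1)),
      sum_Idx_columns_pred N fun k i => Complex.exp (ext N x T k i - ext N x T (k + 1) (i + 1)),
      Finset.mul_sum]
    exact Finset.sum_congr rfl fun i hi => by rw [(h i hi).2]
  unfold giventalIntegrand potential
  rw [hL, hR, ← Complex.exp_add]
  congr 1
  simp only [Finset.sum_add_distrib]
  ring

/-- The variables on the real contour, with `T_{N,i} = x_i`. -/
def realVar (N : ℕ) (x : ℕ → ℝ) (u : Idx N → ℝ) (k i : ℕ) : ℝ :=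
  if h : (k, i) ∈ (Finset.range N ×ˢ Finset.range N).filter (fun p => 1 ≤ p.2 ∧ p.2 ≤ p.1) then
    u ⟨(k, i), h⟩
  else if k = N then x i else 0

/-- The exponential part of Givental's potential on the real contour. -/
noncomputable def todaEnergy (N : ℕ) (x : ℕ → ℝ) (u : Idx N → ℝ) : ℝ :=
  ∑ k ∈ Finset.Icc 1 (N - 1), ∑ i ∈ Finset.Icc 1 k,
    (Real.exp (realVar N x u (k + 1) i - realVar N x u k i) +
      Real.exp (realVar N x u k i - realVar N x u (k + 1) (i + 1)))

lemma ext_ofReal (x : ℕ → ℝ) (u : Idx N → ℝ) (k i : ℕ) :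
    ext N x (fun p => (u p : ℂ)) k i = (realVar N x u k i : ℂ) := by
  unfold ext realVar
  split_ifs <;> simp

/-- With real $\lambda$ and real variables the linear term is a pure phase. -/
lemma norm_exp_potential (hbar : ℝ) (lam x : ℕ → ℝ) (u : Idx N → ℝ) :
    ‖Complex.exp (1 / (hbar : ℂ) * potential N lam x fun p => (u p : ℂ))‖ =
      Real.exp (-(1 / hbar * todaEnergy N x u)) := by
  rw [Complex.norm_exp]
  congr 1
  have h : potential N lam x (fun p => (u p : ℂ)) =
      Complex.I * ((∑ k ∈ Finset.Icc 1 N, lam k * (∑ i ∈ Finset.Icc 1 k, realVar N x u k i -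
        ∑ i ∈ Finset.Icc 1 (k - 1), realVar N x u (k - 1) i) : ℝ) : ℂ) -
      (todaEnergy N x u : ℂ) := by
    simp only [potential, linearTerm, todaEnergy, ext_ofReal]
    push_cast
    rfl
  rw [h, show (1 / (hbar : ℂ)) = ((1 / hbar : ℝ) : ℂ) by push_cast; rfl, Complex.re_ofReal_mul]
  simp

lemma realVar_top (x : ℕ → ℝ) (u : Idx N → ℝ) (i : ℕ) : realVar N x u N i = x i := by
  unfold realVar
  rw [dif_neg (by simp)]
  simp

/-- All terms of the energy are positive, so one may keep only the edges leaving a path `c` with one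
vertex per row. -/
lemma sum_le_todaEnergy (x : ℕ → ℝ) (u : Idx N → ℝ) {k : ℕ} (hk : 1 ≤ k) (c : ℕ → ℕ)
    (hc : ∀ s ∈ Finset.Icc k (N - 1), c s ∈ Finset.Icc 1 s) :
    ∑ s ∈ Finset.Icc k (N - 1),
      (Real.exp (realVar N x u (s + 1) (c s) - realVar N x u s (c s)) +
        Real.exp (realVar N x u s (c s) - realVar N x u (s + 1) (c s + 1))) ≤
      todaEnergy N x u := by
  unfold todaEnergy
  refine (Finset.sum_le_sum fun s hs => Finset.single_le_sum
    (f := fun i => Real.exp (realVar N x u (s + 1) i - realVar N x u s i) +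
      Real.exp (realVar N x u s i - realVar N x u (s + 1) (i + 1)))
    (fun _ _ => by positivity) (hc s hs)).trans ?_
  exact Finset.sum_le_sum_of_subset_of_nonneg (Finset.Icc_subset_Icc_left hk)
    fun _ _ _ => Finset.sum_nonneg fun _ _ => by positivity

/-- Telescoping down column `i` to $x_i$ bounds $T_{k,i}$ from below; telescoping along the diagonal
to $x_{N+i-k}$ bounds it from above. Each edge costs at most its exponential. -/
lemma abs_realVar_le (x : ℕ → ℝ) (u : Idx N → ℝ) {k i : ℕ} (hi : 1 ≤ i) (hik : i ≤ k)
    (hk : k < N) :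
    |realVar N x u k i| ≤ todaEnergy N x u + ∑ j ∈ Finset.Icc 1 N, |x j| := by
  have hexp : ∀ a : ℝ, a ≤ Real.exp a := fun a => by linarith [Real.add_one_le_exp a]
  rw [abs_le]
  constructor
  · have h1 := sum_Icc_succ_sub (fun s => realVar N x u s i) (show k ≤ N - 1 by omega)
    rw [show N - 1 + 1 = N by omega, realVar_top] at h1
    have h2 := sum_le_todaEnergy x u (by omega) (fun _ => i)
      (fun s hs => by simp at hs ⊢; omega : ∀ s ∈ Finset.Icc k (N - 1), i ∈ Finset.Icc 1 s)
    have h3 : ∑ s ∈ Finset.Icc k (N - 1), (realVar N x u (s + 1) i - realVar N x u s i) ≤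
        todaEnergy N x u := by
      refine (Finset.sum_le_sum fun s _ => ?_).trans h2
      exact (hexp _).trans (le_add_of_nonneg_right (Real.exp_pos _).le)
    have h4 := abs_le_sum_abs (N := N) x (i := i) (by simp; omega)
    have h5 := neg_abs_le (x i)
    linarith
  · have h1 := sum_Icc_succ_sub (fun s => -realVar N x u s (i + s - k))
      (show k ≤ N - 1 by omega)
    simp only [show N - 1 + 1 = N by omega, realVar_top, Nat.add_sub_cancel] at h1
    have h2 := sum_le_todaEnergy x u (by omega) (fun s => i + s - k)
      (fun s hs => by simp at hs ⊢; omega :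
        ∀ s ∈ Finset.Icc k (N - 1), i + s - k ∈ Finset.Icc 1 s)
    have h3 : ∑ s ∈ Finset.Icc k (N - 1), (-realVar N x u (s + 1) (i + (s + 1) - k) -
        -realVar N x u s (i + s - k)) ≤ todaEnergy N x u := by
      refine (Finset.sum_le_sum fun s hs => ?_).trans h2
      rw [Finset.mem_Icc] at hs
      rw [show i + (s + 1) - k = i + s - k + 1 by omega, neg_sub_neg]
      exact (hexp _).trans (le_add_of_nonneg_left (Real.exp_pos _).le)
    have h4 := abs_le_sum_abs (N := N) x (i := i + N - k) (by simp; omega)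
    have h5 := le_abs_self (x (i + N - k))
    linarith

lemma integrable_exp_neg_mul_abs {b : ℝ} (hb : 0 < b) :
    Integrable fun t : ℝ => Real.exp (-(b * |t|)) := by
  rw [← integrableOn_univ, ← Set.Iic_union_Ioi (a := (0 : ℝ))]
  refine IntegrableOn.union ?_ ?_
  · refine (integrableOn_exp_mul_Iic hb 0).congr_fun (fun t ht => ?_) measurableSet_Iic
    simp [abs_of_nonpos (Set.mem_Iic.1 ht)]
  · refine (integrableOn_exp_mul_Ioi (neg_neg_of_pos hb) 0).congr_fun (fun t ht => ?_)
      measurableSet_Ioi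
    simp [abs_of_pos (Set.mem_Ioi.1 ht)]

theorem realContour_admissible (hN : 1 ≤ N) {hbar : ℝ} (hhbar : 0 < hbar) (lam : ℕ → ℝ)
    {xiL xiR : ℕ → ℂ}
    (h : ∀ i ∈ Finset.Icc 1 (N - 1), xiL i = -(1 / (hbar : ℂ)) ∧ xiR i = -(1 / (hbar : ℂ))) :
    (realContour N).Admissible hbar lam xiL xiR := by
  intro x r j
  set X : ℝ := ∑ i ∈ Finset.Icc 1 N, |x i| with hX
  set C : ℝ := ‖Complex.exp (∑ i ∈ Finset.Icc 1 N, (x i : ℂ) * (rho N i : ℂ))‖ with hC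
  set d : ℝ := (Fintype.card (Idx N) : ℝ) with hd
  have hd0 : 0 ≤ d := Nat.cast_nonneg _
  -- The rate shares the decay $e^{-Q/\hbar}$ of the energy $Q$ among the `d` variables; `d + 1`
  -- keeps it finite when there are none (`N = 1`).
  set b : ℝ := 1 / (hbar * (d + 1)) with hb
  have hb0 : 0 < b := by positivity
  refine ⟨fun u => C * Real.exp (1 / hbar * (2 * X + r)) * ∏ p, Real.exp (-(b * |u p|)),
    (Integrable.fintype_prod fun _ => integrable_exp_neg_mul_abs hb0).const_mul _,
    fun y hy u => ?_⟩
  have hX0 : 0 ≤ X := Finset.sum_nonneg fun _ _ => abs_nonneg _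
  have hr0 : 0 ≤ r := (abs_nonneg _).trans (hy 1 (by simp; omega))
  set w : Idx N → ℝ := fun p => u p + y p.1.2 + x p.1.2 with hw
  have hpt : (fun p => (realContour N).map j u p + (y p.1.2 : ℂ)) + colShift N x =
      fun p => (w p : ℂ) := by
    ext p
    simp [hw, colShift, realContour]
  beta_reduce
  rw [realContour_vol, mul_one, matrixElementIntegrand_eq hN, norm_mul, hpt,
    giventalIntegrand_eq_exp_potential h, norm_exp_potential, mul_assoc, ← Real.exp_sum,
    ← Real.exp_add]
  refine mul_le_mul_of_nonneg_left (Real.exp_le_exp.2 ?_) (norm_nonneg _)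
  set Q := todaEnergy N x w with hQ
  have hQ0 : 0 ≤ Q := Finset.sum_nonneg fun _ _ => Finset.sum_nonneg fun _ _ => by positivity
  -- One `X` comes from the bottom row in the energy bound; undoing the shifts by `x` and `y` costs
  -- another `X` and `r`.
  have hu : ∀ p : Idx N, |u p| ≤ Q + (2 * X + r) := by
    intro p
    have hp := p.2
    simp only [Finset.mem_filter, Finset.mem_product, Finset.mem_range] at hp
    have h1 := abs_realVar_le x w hp.2.1 hp.2.2 hp.1.1
    have h2 : realVar N x w p.1.1 p.1.2 = w p := by
      unfold realVar
      rw [dif_pos p.2]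
    have hmem : p.1.2 ∈ Finset.Icc 1 N := by simp; omega
    have h3 := abs_le_sum_abs x hmem
    have h4 := hy _ hmem
    rw [h2] at h1
    simp only [hw] at h1
    rw [abs_le] at *
    constructor <;> linarith [h1.1, h1.2, h3.1, h3.2, h4.1, h4.2]
  have hsum : ∑ p, |u p| ≤ d * (Q + (2 * X + r)) := by
    refine (Finset.sum_le_sum fun p _ => hu p).trans (le_of_eq ?_)
    rw [Finset.sum_const, nsmul_eq_mul, Finset.card_univ]
  have h1 : b * ∑ p, |u p| ≤ 1 / hbar * (Q + (2 * X + r)) := by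
    have h2 : b * ∑ p, |u p| ≤ b * ((d + 1) * (Q + (2 * X + r))) := by
      refine mul_le_mul_of_nonneg_left (hsum.trans ?_) hb0.le
      nlinarith
    refine h2.trans (le_of_eq ?_)
    rw [hb]
    field_simp
  rw [Finset.sum_neg_distrib, ← Finset.mul_sum]
  linarith

theorem integrable_exp_potential (hN : 1 ≤ N) {hbar : ℝ} (hhbar : 0 < hbar) (lam : ℕ → ℝ)
    {xiL xiR : ℕ → ℂ}
    (h : ∀ i ∈ Finset.Icc 1 (N - 1), xiL i = -(1 / (hbar : ℂ)) ∧ xiR i = -(1 / (hbar : ℂ)))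
    (x : ℕ → ℝ) : Integrable fun T : Idx N → ℝ =>
      Complex.exp (1 / (hbar : ℂ) * potential N lam x fun p => (T p : ℂ)) := by
  let j : Fin (realContour N).pieces := (0 : Fin 1)
  have h1 := (realContour_admissible hN hhbar lam h).converges_giventalIntegrand hN x j
  have hcont : Continuous fun T : Idx N → ℝ =>
      giventalIntegrand N hbar lam xiL xiR x fun p => (T p : ℂ) :=
    (contDiff_giventalIntegrand hbar lam xiL xiR x).continuous.comp (by fun_prop)
  have h2 : Integrable fun T : Idx N → ℝ =>
      ‖giventalIntegrand N hbar lam xiL xiR x fun p => (T p : ℂ)‖ := by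
    refine h1.congr (Eventually.of_forall fun u => ?_)
    have hvol := realContour_vol j u
    beta_reduce
    rw [hvol, mul_one]
    rfl
  exact ((integrable_norm_iff hcont.aestronglyMeasurable).1 h2).congr
    (Eventually.of_forall fun T => giventalIntegrand_eq_exp_potential h x _)

end RealContour

end GaussGivental

/-- The sequences `lam`, `xiL`, `xiR`, `x` are indexed from `1`, as in `λ_1, …, λ_N`; only the
entries `1, …, N` (for `xiL`, `xiR`: `1, …, N - 1`) enter. -/
theorem mainTheorem1 (N : ℕ) (hN : 1 ≤ N) (hbar : ℝ) (hhbar : 0 < hbar) (lam : ℕ → ℝ)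
    (xiL xiR : ℕ → ℂ) :
    -- `ψ_R`, `ψ_L` are Whittaker vectors, and `cartan` is the integrated Cartan action
    GaussGivental.IsRightWhittaker N xiR (GaussGivental.psiR N xiR) ∧
    GaussGivental.IsLeftWhittaker N (GaussGivental.mu N hbar lam) xiL
      (GaussGivental.psiL N (GaussGivental.mu N hbar lam) xiL) ∧
    GaussGivental.IntegratesCartan N (GaussGivental.mu N hbar lam)
      (GaussGivental.cartan N (GaussGivental.mu N hbar lam)) ∧
    -- the integral representation
    (∀ G : GaussGivental.Contour N, G.Admissible hbar lam xiL xiR → ∀ x : ℕ → ℝ,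
      G.Converges (GaussGivental.matrixElementIntegrand N hbar lam xiL xiR x) ∧
      G.Converges (GaussGivental.giventalIntegrand N hbar lam xiL xiR x) ∧
      GaussGivental.waveFunction N hbar lam xiL xiR G x =
        G.integral (GaussGivental.giventalIntegrand N hbar lam xiL xiR x)) ∧
    -- the case `ξ_L = ξ_R = -1/ħ`: Givental's formula, and the real contour
    ((∀ i ∈ Finset.Icc 1 (N - 1), xiL i = -(1 / (hbar : ℂ)) ∧ xiR i = -(1 / (hbar : ℂ))) →
      (∀ G : GaussGivental.Contour N, G.Admissible hbar lam xiL xiR → ∀ x : ℕ → ℝ,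
        GaussGivental.waveFunction N hbar lam xiL xiR G x =
          G.integral (fun T =>
            Complex.exp (1 / (hbar : ℂ) * GaussGivental.potential N lam x T))) ∧
      (GaussGivental.realContour N).Admissible hbar lam xiL xiR ∧
      ∀ x : ℕ → ℝ,
        MeasureTheory.Integrable (fun T : GaussGivental.Idx N → ℝ =>
          Complex.exp (1 / (hbar : ℂ) *
            GaussGivental.potential N lam x (fun p => (T p : ℂ)))) ∧
        GaussGivental.waveFunction N hbar lam xiL xiR (GaussGivental.realContour N) x =
          ∫ T : GaussGivental.Idx N → ℝ, Complex.exp (1 / (hbar : ℂ) *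
            GaussGivental.potential N lam x (fun p => (T p : ℂ)))) := by
  refine ⟨GaussGivental.isRightWhittaker_psiR N xiR, GaussGivental.isLeftWhittaker_psiL N _ xiL,
    GaussGivental.integratesCartan_cartan N _, fun G hG x =>
      ⟨hG.converges_matrixElementIntegrand hN x, hG.converges_giventalIntegrand hN x,
        GaussGivental.waveFunction_eq_integral hN hG x⟩, fun h => ?_⟩
  have hform : ∀ G : GaussGivental.Contour N, G.Admissible hbar lam xiL xiR → ∀ x : ℕ → ℝ,
      GaussGivental.waveFunction N hbar lam xiL xiR G x = G.integral (fun T =>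
        Complex.exp (1 / (hbar : ℂ) * GaussGivental.potential N lam x T)) := by
    intro G hG x
    rw [GaussGivental.waveFunction_eq_integral hN hG x]
    exact congrArg G.integral
      (funext (GaussGivental.giventalIntegrand_eq_exp_potential h x))
  have hreal := GaussGivental.realContour_admissible hN hhbar lam h
  refine ⟨hform, hreal, fun x => ⟨GaussGivental.integrable_exp_potential hN hhbar lam h x, ?_⟩⟩
  rw [hform _ hreal x, GaussGivental.realContour_integral]
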